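/- Let $t^{1/4}\in\mathbb{C}^\ast$ and let $A=\{z\in\mathbb{C}\mid 1\le |z|\le 2\}$. An $(m,n)$-tangle diagram in $A$ consists of finitely many loops and arcs with over/under information at the crossings; the endpoints of the arcs are the $m$ points $e^{2\pi i(j-1)/m}$ on the inner circle and the $n$ points $2e^{2\pi i(j-1)/n}$ on the outer circle. Diagrams are considered up to planar isotopy fixing $\partial A$. Let $\mathrm{Hom}_{\mathcal S}(m,n)$ be the complex vector space spanned by the classes $[D]$ of $(m,n)$-tangle diagrams, modulo the Kauffman skein relation and the removal of a contractible loop by the factor $-(t^{1/2}+t^{-1/2})$. The Kauffman relation replaces a crossing by $t^{1/4}$ times the smoothing that joins the two regions swept out by turning the over-strand clockwise, plus $t^{-1/4}$ times the other smoothing. The composition $Y\circ Z$ places $Z$ inside $Y$. The relative skein product is the bilinear map $$\times_{\mathcal S}:\mathrm{Hom}_{\mathcal S}(k,l)\times \mathrm{Hom}_{\mathcal S}(m,n)\to \mathrm{Hom}_{\mathcal S}(k+m,l+n),\qquad [D]\times_{\mathcal S}[D']=[D\ast D'].$$ Here $D\ast D'$ is obtained by rotating the endpoints of $D$ clockwise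 to the first $k$ (inner) and the first $l$ (outer) marked points, rotating those of $D'$ counterclockwise to the last $m$ (inner) and the last $n$ (outer) marked points, in both cases by a planar isotopy that preserves a radial segment at an angle slightly less than $2\pi$, and placing $D$ on top of $D'$. Let $X\in\mathrm{Hom}_{\mathcal S}(0,0)$ be the class of a noncontractible simple loop, and let $\rho\in\mathrm{Hom}_{\mathcal S}(1,1)$ be the class of an arc from the inner to the outer boundary that winds once counterclockwise. Let $c_+,c_-$ be the $(0,2)$-diagrams that consist of one arc joining $2$ and $-2$ through the upper, respectively the lower, half of the annulus, and put $U=t^{1/4}[c_+]+[c_-]$ (twist weight $v=1$). Write $\overline n\in\{0,1\}$ for $n$ modulo $2$, and set $s_0=t^{1/4}+t^{-1/4}$, $s_1=1$. For even $n$ let $V_n(s_0)$ be the quotient of $\mathrm{Hom}_{\mathcal S}(0,n)$ by all $Y\circ X-s_0Y$; for odd $n$ let $V_n(s_1)$ be the quotient of $\mathrm{Hom}_{\mathcal S}(1,n)$ by all $Y\circ\rho-Y$. Write $\overline Y_n\in V_n(s_{\overline n})$ for the class of $Y\in \mathrm{Hom}_{\mathcal S}(\overline n,n)$. Then the products $\times_{\mathcal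 S}$ are well defined, and $\mathcal A=\bigoplus_{n\ge 0}V_n(s_{\overline n})$ is an $\mathbb{Z}_{\ge 0}$-graded associative unital complex algebra with multiplication $$\overline Y_m\cdot\overline Z_n=\begin{cases}\overline{(Y\times_{\mathcal S}Z)}_{m+n} & \text{if } (\overline m,\overline n)\neq(1,1),\\ \overline{((Y\times_{\mathcal S}Z)\circ U)}_{m+n} & \text{if } (\overline m,\overline n)=(1,1)\end{cases}$$ for $Y\in\mathrm{Hom}_{\mathcal S}(\overline m,m)$ and $Z\in\mathrm{Hom}_{\mathcal S}(\overline n,n)$. Its unit is the class $\overline\emptyset_0\in V_0(s_0)$ of the empty diagram. -/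

import Mathlib

open scoped DirectSum

namespace AnnularSkein

/-!
Tangle diagrams on the annulus `A = {1 ≤ |z| ≤ 2}`.  A diagram is given in general position with
respect to the radius and to the cut, a radial segment at an angle slightly less than `2π`.  Read
from the inner boundary circle outwards, it is a finite sequence of elementary pieces; every planar isotopy class
has such representatives.  On a circle
of constant radius the strands are numbered `0, 1, 2, …` counterclockwise, starting at the cut.  In
particular the `j`-th of `n` marked points on a boundary circle, at the angle `2π(j-1)/n`, carries
the number `j - 1`.
-/

/-- The elementary events of a diagram away from the cut, read outwards:
* `cup`: a new arc is born (a local minimum of the radius);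
* `cap`: two neighbouring strands are joined (a local maximum of the radius);
* `cross top`: the strand in position `i` moves to position `i + 1` and the strand in position
  `i + 1` moves to position `i`; the first of the two passes over the second if `top = true`, and
  under it if `top = false`. -/
inductive Event : Type
  | cup : Event
  | cap : Event
  | cross (top : Bool) : Event

/-- The number of strands that enter an event from the inside. -/
def Event.ins : Event → ℕ
  | .cup => 0
  | .cap => 2
  | .cross _ => 2

/-- The number of strands that leave an event to the outside. -/
def Event.outs : Event → ℕ
  | .cup => 2
  | .cap => 0
  | .cross _ => 2

/-- An elementary piece of a diagram, read outwards:
* `event e i`: the event `e` takes place, and its strands occupy the positions `i, i + 1, …`; the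
  other strands are radial;
* `rot`: the last strand passes counterclockwise through the cut and becomes strand `0`;
* `rotInv`: strand `0` passes clockwise through the cut and becomes the last strand. -/
inductive Piece : Type
  | event (e : Event) (i : ℕ) : Piece
  | rot : Piece
  | rotInv : Piece

/-- The piece can be placed outside of a circle with `m` strands, and leaves `n` strands. -/
def Piece.Fits : Piece → ℕ → ℕ → Prop
  | .event e i, m, n => i + e.ins ≤ m ∧ n + e.ins = m + e.outs
  | .rot, m, n => 0 < m ∧ n = m
  | .rotInv, m, n => 0 < m ∧ n = m

/-- The pieces can be placed outside of each other, beginning with `m` strands and ending with `n`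
strands. -/
def Fits : List Piece → ℕ → ℕ → Prop
  | [], m, n => m = n
  | s :: w, m, n => ∃ p, s.Fits m p ∧ Fits w p n

theorem Fits.append {v w : List Piece} {k m n : ℕ} (hv : Fits v k m) (hw : Fits w m n) :
    Fits (v ++ w) k n := by
  induction v generalizing k with
  | nil => cases hv; exact hw
  | cons s v ih =>
    obtain ⟨p, hp, hv⟩ := hv
    exact ⟨p, hp, ih hv⟩

/-- An `(m, n)`-tangle diagram on the annulus: `m` endpoints on the inner boundary circle and `n`
endpoints on the outer one.  The word lists its pieces from the inside to the outside. -/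
structure Diagram (m n : ℕ) where
  word : List Piece
  fits : Fits word m n

/-- `E.comp D` is `E ∘ D`: the diagram `D` is placed inside of `E`. -/
def Diagram.comp {k m n : ℕ} (E : Diagram m n) (D : Diagram k m) : Diagram k n :=
  ⟨D.word ++ E.word, D.fits.append E.fits⟩

/-- The identity diagram: `n` radial segments. -/
def Diagram.one (n : ℕ) : Diagram n n := ⟨[], rfl⟩

/-- The elementary planar isotopies (rel boundary) of a part of a diagram that begins with `m`
strands.  No Reidemeister move is among them. -/
inductive Move (m : ℕ) : List Piece → List Piece → Prop
  /-- Two events at disjoint angles can happen in either order. -/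
  | interchange (x y : Event) (i d : ℕ) :
      Move m [.event x i, .event y (i + x.outs + d)] [.event y (i + x.ins + d), .event x i]
  /-- A local minimum and a local maximum of the radius on a strand cancel. -/
  | zigzag (i : ℕ) : Move m [.event .cup (i + 1), .event .cap i] []
  /-- The mirror image of the previous move. -/
  | zagzig (i : ℕ) : Move m [.event .cup i, .event .cap (i + 1)] []
  /-- A crossing slides along an arc through a local maximum of the radius. -/
  | capSlide (o : Bool) (i : ℕ) :
      Move m [.event (.cross o) (i + 1), .event .cap i]
        [.event (.cross (!o)) i, .event .cap (i + 1)]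
  /-- A crossing slides along an arc through a local minimum of the radius. -/
  | cupSlide (o : Bool) (i : ℕ) :
      Move m [.event .cup i, .event (.cross o) (i + 1)]
        [.event .cup (i + 1), .event (.cross (!o)) i]
  /-- A strand that passes through the cut and back is pulled off the cut. -/
  | rotCancel : Move m [.rot, .rotInv] []
  /-- A strand that passes back through the cut and forth again is pulled off the cut. -/
  | rotInvCancel : Move m [.rotInv, .rot] []
  /-- The passing of the last strand through the cut can happen before or after an event that does
  not involve this strand. -/
  | rotEvent (x : Event) (i : ℕ) (h : i + x.ins < m) :
      Move m [.event x i, .rot] [.rot, .event x (i + 1)]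
  /-- An event that involves the last strands is moved through the cut. -/
  | cutEvent (x : Event) (i : ℕ) (h : i + x.ins = m) :
      Move m (.event x i :: List.replicate x.outs .rot)
        (List.replicate x.ins .rot ++ [.event x 0])

/-- Two diagrams differ by one elementary planar isotopy. -/
def Step {m n : ℕ} (D D' : Diagram m n) : Prop :=
  ∃ (A B u v : List Piece) (p : ℕ), Fits A m p ∧ Move p u v ∧
    D.word = A ++ u ++ B ∧ D'.word = A ++ v ++ B

/-- The morphisms `m → n` of the category of tangle diagrams: `(m, n)`-tangle diagrams up to planar
isotopy fixing the boundary, which is the equivalence relation generated by `Step`. -/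
def HomT (m n : ℕ) : Type := Quot (@Step m n)

/-- The planar isotopy class of a diagram. -/
def HomT.mk {m n : ℕ} (D : Diagram m n) : HomT m n := Quot.mk _ D

theorem Step.comp_left {k m n : ℕ} {E E' : Diagram m n} (h : Step E E') (D : Diagram k m) :
    Step (E.comp D) (E'.comp D) := by
  obtain ⟨A, B, u, v, p, hA, hm, h1, h2⟩ := h
  exact ⟨D.word ++ A, B, u, v, p, D.fits.append hA, hm, by simp [Diagram.comp, h1],
    by simp [Diagram.comp, h2]⟩

theorem Step.comp_right {k m n : ℕ} (E : Diagram m n) {D D' : Diagram k m} (h : Step D D') :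
    Step (E.comp D) (E.comp D') := by
  obtain ⟨A, B, u, v, p, hA, hm, h1, h2⟩ := h
  exact ⟨A, B ++ E.word, u, v, p, hA, hm, by simp [Diagram.comp, h1],
    by simp [Diagram.comp, h2]⟩

/-- Composition of planar isotopy classes of diagrams. -/
def HomT.comp {k m n : ℕ} (E : HomT m n) (D : HomT k m) : HomT k n :=
  Quot.map₂ Diagram.comp (fun E _ _ h => Step.comp_right E h) (fun _ _ D h => Step.comp_left h D)
    E D

noncomputable section

/-- The defining relations of the skein module, with `q = t^{1/4}`: the Kauffman skein relation for
a crossing of either kind, and the removal of a contractible loop.  The diagrams agree in `A` and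
`B`, that is, outside of a small disc.

The smoothing with coefficient `q` is the one that joins the two regions swept out by turning the
over-strand clockwise.  For `cross true` it consists of two radial strands,
for `cross false` of a cap followed by a cup. -/
inductive SkeinRel (q : ℂ) (m n : ℕ) : (HomT m n →₀ ℂ) → Prop
  | kauffmanOver (A B : List Piece) (i : ℕ) (D D' D'' : Diagram m n)
      (h : D.word = A ++ [.event (.cross true) i] ++ B)
      (h' : D'.word = A ++ B)
      (h'' : D''.word = A ++ [.event .cap i, .event .cup i] ++ B) :
      SkeinRel q m n (Finsupp.single (.mk D) 1
        - (q • Finsupp.single (.mk D') 1 + q⁻¹ • Finsupp.single (.mk D'') 1))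
  | kauffmanUnder (A B : List Piece) (i : ℕ) (D D' D'' : Diagram m n)
      (h : D.word = A ++ [.event (.cross false) i] ++ B)
      (h' : D'.word = A ++ [.event .cap i, .event .cup i] ++ B)
      (h'' : D''.word = A ++ B) :
      SkeinRel q m n (Finsupp.single (.mk D) 1
        - (q • Finsupp.single (.mk D') 1 + q⁻¹ • Finsupp.single (.mk D'') 1))
  | loop (A B : List Piece) (i : ℕ) (D D' : Diagram m n)
      (h : D.word = A ++ [.event .cup i, .event .cap i] ++ B)
      (h' : D'.word = A ++ B) :
      SkeinRel q m n (Finsupp.single (.mk D) 1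
        - (-(q ^ 2 + (q ^ 2)⁻¹)) • Finsupp.single (.mk D') 1)

/-- The subspace of linear combinations of diagrams that vanish in the skein. -/
def skeinSubmodule (q : ℂ) (m n : ℕ) : Submodule ℂ (HomT m n →₀ ℂ) :=
  Submodule.span ℂ {x | SkeinRel q m n x}

/-- The morphisms `m → n` of the skein category of the annulus with parameter `q = t^{1/4}`. -/
def HomS (q : ℂ) (m n : ℕ) : Type := (HomT m n →₀ ℂ) ⧸ skeinSubmodule q m n

instance (q : ℂ) (m n : ℕ) : AddCommGroup (HomS q m n) :=
  inferInstanceAs (AddCommGroup ((HomT m n →₀ ℂ) ⧸ skeinSubmodule q m n))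

instance (q : ℂ) (m n : ℕ) : Module ℂ (HomS q m n) :=
  inferInstanceAs (Module ℂ ((HomT m n →₀ ℂ) ⧸ skeinSubmodule q m n))

/-- The class `[D]` of a diagram in the skein. -/
def cls (q : ℂ) {m n : ℕ} (D : Diagram m n) : HomS q m n :=
  Submodule.Quotient.mk (Finsupp.single (.mk D) 1)

/-- Composition of formal linear combinations of diagrams. -/
def linComp (k m n : ℕ) : (HomT m n →₀ ℂ) →ₗ[ℂ] (HomT k m →₀ ℂ) →ₗ[ℂ] (HomT k n →₀ ℂ) :=
  Finsupp.lsum ℂ fun E => (LinearMap.lsmul ℂ _).flip (Finsupp.lmapDomain ℂ ℂ fun D => E.comp D)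

theorem linComp_single (k m n : ℕ) (E : HomT m n) (D : HomT k m) :
    linComp k m n (Finsupp.single E 1) (Finsupp.single D 1) = Finsupp.single (E.comp D) 1 := by
  simp [linComp]

theorem SkeinRel.comp_left {q : ℂ} {k m n : ℕ} {x : HomT m n →₀ ℂ} (hx : SkeinRel q m n x)
    (D : HomT k m) : SkeinRel q k n (linComp k m n x (Finsupp.single D 1)) := by
  obtain ⟨F, rfl⟩ : ∃ F, D = HomT.mk F := (Quot.exists_rep D).imp fun _ h => h.symm
  cases hx with
  | kauffmanOver A B i D D' D'' h h' h'' =>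
    simp only [map_sub, map_add, map_smul, LinearMap.sub_apply, LinearMap.add_apply,
      LinearMap.smul_apply, linComp_single]
    exact .kauffmanOver (F.word ++ A) B i (D.comp F) (D'.comp F) (D''.comp F)
      (by simp [Diagram.comp, h]) (by simp [Diagram.comp, h']) (by simp [Diagram.comp, h''])
  | kauffmanUnder A B i D D' D'' h h' h'' =>
    simp only [map_sub, map_add, map_smul, LinearMap.sub_apply, LinearMap.add_apply,
      LinearMap.smul_apply, linComp_single]
    exact .kauffmanUnder (F.word ++ A) B i (D.comp F) (D'.comp F) (D''.comp F)
      (by simp [Diagram.comp, h]) (by simp [Diagram.comp, h']) (by simp [Diagram.comp, h''])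
  | loop A B i D D' h h' =>
    simp only [map_sub, map_smul, LinearMap.sub_apply, LinearMap.smul_apply, linComp_single]
    exact .loop (F.word ++ A) B i (D.comp F) (D'.comp F)
      (by simp [Diagram.comp, h]) (by simp [Diagram.comp, h'])

theorem SkeinRel.comp_right {q : ℂ} {k m n : ℕ} (E : HomT m n) {x : HomT k m →₀ ℂ}
    (hx : SkeinRel q k m x) : SkeinRel q k n (linComp k m n (Finsupp.single E 1) x) := by
  obtain ⟨F, rfl⟩ : ∃ F, E = HomT.mk F := (Quot.exists_rep E).imp fun _ h => h.symm
  cases hx with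
  | kauffmanOver A B i D D' D'' h h' h'' =>
    simp only [map_sub, map_add, map_smul, linComp_single]
    exact .kauffmanOver A (B ++ F.word) i (F.comp D) (F.comp D') (F.comp D'')
      (by simp [Diagram.comp, h]) (by simp [Diagram.comp, h']) (by simp [Diagram.comp, h''])
  | kauffmanUnder A B i D D' D'' h h' h'' =>
    simp only [map_sub, map_add, map_smul, linComp_single]
    exact .kauffmanUnder A (B ++ F.word) i (F.comp D) (F.comp D') (F.comp D'')
      (by simp [Diagram.comp, h]) (by simp [Diagram.comp, h']) (by simp [Diagram.comp, h''])
  | loop A B i D D' h h' =>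
    simp only [map_sub, map_smul, linComp_single]
    exact .loop A (B ++ F.word) i (F.comp D) (F.comp D')
      (by simp [Diagram.comp, h]) (by simp [Diagram.comp, h'])

theorem linComp_mem_left {q : ℂ} {k m n : ℕ} {x : HomT m n →₀ ℂ} (hx : x ∈ skeinSubmodule q m n)
    (y : HomT k m →₀ ℂ) : linComp k m n x y ∈ skeinSubmodule q k n := by
  induction y using Finsupp.induction_linear with
  | zero => simp
  | add y z hy hz => rw [map_add]; exact add_mem hy hz
  | single D c =>
    rw [← mul_one c, ← smul_eq_mul, ← Finsupp.smul_single, map_smul]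
    refine Submodule.smul_mem _ _ ?_
    induction hx using Submodule.span_induction with
    | mem x hx => exact Submodule.subset_span (hx.comp_left D)
    | zero => simp
    | add x y _ _ hx hy => rw [map_add, LinearMap.add_apply]; exact add_mem hx hy
    | smul a x _ hx => rw [map_smul, LinearMap.smul_apply]; exact Submodule.smul_mem _ _ hx

theorem linComp_mem_right {q : ℂ} {k m n : ℕ} (x : HomT m n →₀ ℂ) {y : HomT k m →₀ ℂ}
    (hy : y ∈ skeinSubmodule q k m) : linComp k m n x y ∈ skeinSubmodule q k n := by
  induction x using Finsupp.induction_linear with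
  | zero => simp
  | add x z hx hz => rw [map_add, LinearMap.add_apply]; exact add_mem hx hz
  | single E c =>
    rw [← mul_one c, ← smul_eq_mul, ← Finsupp.smul_single, map_smul, LinearMap.smul_apply]
    refine Submodule.smul_mem _ _ ?_
    induction hy using Submodule.span_induction with
    | mem y hy => exact Submodule.subset_span (hy.comp_right E)
    | zero => simp
    | add x y _ _ hx hy => rw [map_add]; exact add_mem hx hy
    | smul a x _ hx => rw [map_smul]; exact Submodule.smul_mem _ _ hx

/-- Composition in the skein category: `comp q k m n Y Z = Y ∘ Z`. -/
def comp (q : ℂ) (k m n : ℕ) : HomS q m n →ₗ[ℂ] HomS q k m →ₗ[ℂ] HomS q k n :=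
  (skeinSubmodule q m n).liftQ
    (LinearMap.mk₂ ℂ
      (fun x => (skeinSubmodule q k m).liftQ ((skeinSubmodule q k n).mkQ ∘ₗ linComp k m n x)
        (fun y hy => by
          simpa using linComp_mem_right x hy))
      (fun x x' y => by
        induction y using Submodule.Quotient.induction_on with
        | H y =>
          simp only [map_add, LinearMap.add_apply, Submodule.liftQ_apply, LinearMap.comp_apply]
          rfl)
      (fun c x y => by
        induction y using Submodule.Quotient.induction_on with
        | H y =>
          simp only [map_smul, LinearMap.smul_apply, Submodule.liftQ_apply, LinearMap.comp_apply]
          rfl)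
      (fun x y y' => map_add _ y y')
      (fun c x y => map_smul _ c y))
    (fun x hx => by
      rw [LinearMap.mem_ker]
      refine LinearMap.ext fun y => ?_
      induction y using Submodule.Quotient.induction_on with
      | H y => exact (Submodule.Quotient.mk_eq_zero _).2 (linComp_mem_left hx y))

theorem comp_cls (q : ℂ) {k m n : ℕ} (E : Diagram m n) (D : Diagram k m) :
    comp q k m n (cls q E) (cls q D) = cls q (E.comp D) :=
  congrArg Submodule.Quotient.mk (linComp_single k m n (.mk E) (.mk D))

/-- The word of `D ∗ Id_c`, for `D` the word of a diagram that begins with `p` strands: `c` radial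
strands are added at the last positions, and the strands of `D` pass over them. -/
def addRight (c : ℕ) : ℕ → List Piece → List Piece
  | _, [] => []
  | p, .event e i :: w => .event e i :: addRight c (p - e.ins + e.outs) w
  | p, .rot :: w =>
      (List.range c).map (fun j => .event (.cross true) (p - 1 + j)) ++
        .rot :: addRight c p w
  | p, .rotInv :: w =>
      .rotInv :: ((List.range c).reverse.map (fun j => .event (.cross false) (p - 1 + j)) ++
        addRight c p w)

/-- The word of `Id_c ∗ D`, for `D` the word of a diagram: `c` radial strands are added at the
first positions, and the strands of `D` pass under them. -/
def addLeft (c : ℕ) : List Piece → List Piece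
  | [] => []
  | .event e i :: w => .event e (c + i) :: addLeft c w
  | .rot :: w =>
      .rot :: ((List.range c).map (fun j => .event (.cross false) j) ++ addLeft c w)
  | .rotInv :: w =>
      (List.range c).reverse.map (fun j => .event (.cross true) j) ++ .rotInv :: addLeft c w

theorem fits_crossings (l : List ℕ) (f : ℕ → ℕ) (o : Bool) (N : ℕ) (h : ∀ j ∈ l, f j + 2 ≤ N) :
    Fits (l.map fun j => Piece.event (.cross o) (f j)) N N := by
  induction l with
  | nil => rfl
  | cons a l ih =>
    exact ⟨N, ⟨h a (by simp), rfl⟩, ih fun j hj => h j (by simp [hj])⟩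

theorem fits_addRight (c : ℕ) {w : List Piece} {k l : ℕ} (h : Fits w k l) :
    Fits (addRight c k w) (k + c) (l + c) := by
  induction w generalizing k with
  | nil => cases h; rfl
  | cons s w ih =>
    obtain ⟨p, hs, hw⟩ := h
    cases s with
    | event e i =>
      obtain ⟨h1, h2⟩ := hs
      have hp : k - e.ins + e.outs = p := by omega
      exact ⟨p + c, ⟨by omega, by omega⟩, by subst hp; exact ih hw⟩
    | rot =>
      obtain ⟨h1, rfl⟩ := hs
      refine Fits.append (m := p + c) (fits_crossings _ (fun j => p - 1 + j) true _ fun j hj => ?_)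
        ⟨p + c, ⟨by omega, rfl⟩, ih hw⟩
      have := List.mem_range.1 hj
      omega
    | rotInv =>
      obtain ⟨h1, rfl⟩ := hs
      refine ⟨p + c, ⟨by omega, rfl⟩,
        Fits.append (m := p + c) (fits_crossings _ (fun j => p - 1 + j) false _ fun j hj => ?_) (ih hw)⟩
      have := List.mem_range.1 (List.mem_reverse.1 hj)
      omega

theorem fits_addLeft (c : ℕ) {w : List Piece} {m n : ℕ} (h : Fits w m n) :
    Fits (addLeft c w) (c + m) (c + n) := by
  induction w generalizing m with
  | nil => cases h; rfl
  | cons s w ih =>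
    obtain ⟨p, hs, hw⟩ := h
    cases s with
    | event e i =>
      obtain ⟨h1, h2⟩ := hs
      exact ⟨c + p, ⟨by omega, by omega⟩, ih hw⟩
    | rot =>
      obtain ⟨h1, rfl⟩ := hs
      refine ⟨c + p, ⟨by omega, rfl⟩,
        Fits.append (m := c + p) (fits_crossings _ (fun j => j) false _ fun j hj => ?_) (ih hw)⟩
      have := List.mem_range.1 hj
      omega
    | rotInv =>
      obtain ⟨h1, rfl⟩ := hs
      refine Fits.append (m := c + p) (fits_crossings _ (fun j => j) true _ fun j hj => ?_)
        ⟨c + p, ⟨by omega, rfl⟩, ih hw⟩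
      have := List.mem_range.1 (List.mem_reverse.1 hj)
      omega

/-- The diagram `D ∗ E` of the relative skein product.  The endpoints of `D` are rotated clockwise
to the first marked points of each boundary circle, those of `E` counterclockwise to the last ones
(the cut stays fixed), and `D` is placed on top of `E`.  The representatives are chosen so that all
events of `E` happen at a smaller radius than those of `D`. -/
def Diagram.star {k l m n : ℕ} (D : Diagram k l) (E : Diagram m n) : Diagram (k + m) (l + n) :=
  ⟨addLeft k E.word ++ addRight n k D.word,
    (fits_addLeft k E.fits).append (fits_addRight n D.fits)⟩

/-- For `e = 0` the class `X` of an essential simple loop, and for `e ≥ 1` the class `ρ` of the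
diagram that joins the inner endpoint `j` with the outer endpoint `j + 1` modulo `e` by turning
counterclockwise (for `e = 1` the Dehn twist of a radial segment). -/
def turn (q : ℂ) : (e : ℕ) → HomS q e e
  | 0 => cls q ⟨[.event .cup 0, .rot, .event .cap 0],
      ⟨2, ⟨le_rfl, rfl⟩, 2, ⟨by norm_num, rfl⟩, 0, ⟨le_rfl, rfl⟩, rfl⟩⟩
  | e + 1 => cls q ⟨[.rot], ⟨e + 1, ⟨Nat.succ_pos e, rfl⟩, rfl⟩⟩

/-- The `(0, 2)`-diagram `c₊`: an arc through the angle `π / 2`. -/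
def cPlus : Diagram 0 2 := ⟨[.event .cup 0], ⟨2, ⟨le_rfl, rfl⟩, rfl⟩⟩

/-- The `(0, 2)`-diagram `c₋`: an arc through the angle `3π / 2`. -/
def cMinus : Diagram 0 2 :=
  ⟨[.event .cup 0, .rot], ⟨2, ⟨le_rfl, rfl⟩, 2, ⟨by norm_num, rfl⟩, rfl⟩⟩

/-- The element `U = t^{1/4} [c₊] + v [c₋]` for the twist weight `v`. -/
def U (q v : ℂ) : HomS q 0 2 := q • cls q cPlus + v • cls q cMinus

/-- The subspace spanned by all `Y ∘ w - s Y`, with `w = X` for even `n` and `w = ρ` for odd `n`. -/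
def weightSubmodule (q s : ℂ) (n : ℕ) : Submodule ℂ (HomS q (n % 2) n) :=
  Submodule.span ℂ
    {x | ∃ Y : HomS q (n % 2) n, x = comp q (n % 2) (n % 2) n Y (turn q (n % 2)) - s • Y}

/-- The module `V_n(s)` of the link pattern tower: `Hom(0, n) ⊗_{ℂ[X]} ℂ_s` for even `n` and
`Hom(1, n) ⊗_{ℂ[ρ^±1]} ℂ_s` for odd `n`, where `X`, respectively `ρ`, acts on `ℂ_s` by `s`. -/
def V (q s : ℂ) (n : ℕ) : Type := HomS q (n % 2) n ⧸ weightSubmodule q s n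

instance (q s : ℂ) (n : ℕ) : AddCommGroup (V q s n) :=
  inferInstanceAs (AddCommGroup (HomS q (n % 2) n ⧸ weightSubmodule q s n))

instance (q s : ℂ) (n : ℕ) : Module ℂ (V q s n) :=
  inferInstanceAs (Module ℂ (HomS q (n % 2) n ⧸ weightSubmodule q s n))

/-- The weights for twist weight `v = 1`: `s_0 = t^{1/4} + t^{-1/4}` and `s_1 = 1`. -/
def weight (q : ℂ) (n : ℕ) : ℂ := if n % 2 = 0 then q + q⁻¹ else 1

/-- The graded pieces `V_n(s_{n mod 2})` of the algebra. -/
abbrev LinkSpace (q : ℂ) (n : ℕ) : Type := V q (weight q n) n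

/-- The class in `V_n(s_{n mod 2})` of an element of `Hom(a, n)`, where `a = n mod 2`. -/
def toV (q : ℂ) {a n : ℕ} (h : a = n % 2) : HomS q a n →ₗ[ℂ] LinkSpace q n :=
  match a, h with
  | _, rfl => (weightSubmodule q (weight q n) n).mkQ

end

end AnnularSkein

namespace AnnularSkein

section

/-! ### Evaluation of words in the skein -/

/-! Diagrams are words, and `D ∗ E` is the word of `E` with radial strands above it, followed by the
word of `D` with radial strands below it. Identities in the skein are proved for words, by means of
`Rel`, a congruence for concatenation. Planar isotopy contains no Reidemeister move, but the
Kauffman relation and the loop value give Reidemeister II (`rel_crossCancel`). Reidemeister III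
follows by smoothing the crossing that is to be passed (`rel_event_passLeft`). Reidemeister I fails
in the skein and is not needed.

With these moves, planar isotopies survive the addition of strands (`Move.rel_addRight`,
`Move.rel_addLeft`). The skein relations are local, so the product descends to `skeinProd`. A piece
of the upper diagram and a piece of the lower one can be exchanged (`rel_commute`), which yields the
interchange law `skeinProd_comp`. Associativity of `skeinProd` holds already for words.

By the interchange law, the descent to the quotients `V` reduces to a few small diagrams. An
essential loop over a radial strand is `q ρ + q⁻¹ ρ⁻¹`, below it `q⁻¹ ρ + q ρ⁻¹`; for `ρ = 1` both
become `q + q⁻¹`, the weight of `X`. The elements `(ρ × 1) ∘ U` and `(1 × ρ) ∘ U` differ from `U` by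
multiples of `c₋ ∘ X - s₀ c₋` and `c₊ ∘ X - s₀ c₊` respectively (`skeinProd_turn_one_comp_U`,
`skeinProd_one_turn_comp_U`), which vanish in the quotient.

Associativity of the algebra is formal if at most two factors are odd. For three odd factors it says
that `U × 1` and `1 × U` agree once `ρ = 1` (`toV_comp_skeinProd_U`). -/

theorem Piece.Fits.unique {s : Piece} {m n n' : ℕ} (h : s.Fits m n) (h' : s.Fits m n') :
    n = n' := by
  cases s <;> simp only [Piece.Fits] at h h' <;> omega

theorem Fits.unique {w : List Piece} {m n n' : ℕ} (h : Fits w m n) (h' : Fits w m n') :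
    n = n' := by
  induction w generalizing m with
  | nil => exact h.symm.trans h'
  | cons s w ih =>
    obtain ⟨p, hp, hw⟩ := h
    obtain ⟨p', hp', hw'⟩ := h'
    obtain rfl := hp.unique hp'
    exact ih hw hw'

theorem fits_append {v w : List Piece} {k n : ℕ} :
    Fits (v ++ w) k n ↔ ∃ m, Fits v k m ∧ Fits w m n := by
  refine ⟨fun h => ?_, fun ⟨m, hv, hw⟩ => hv.append hw⟩
  induction v generalizing k with
  | nil => exact ⟨k, rfl, h⟩
  | cons s v ih =>
    obtain ⟨p, hp, h⟩ := h
    obtain ⟨m, hv, hw⟩ := ih h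
    exact ⟨m, ⟨p, hp, hv⟩, hw⟩

theorem HomS.induction {q : ℂ} {m n : ℕ} {P : HomS q m n → Prop} (x : HomS q m n)
    (hz : P 0) (ha : ∀ x y, P x → P y → P (x + y)) (hs : ∀ (c : ℂ) x, P x → P (c • x))
    (hc : ∀ D : Diagram m n, P (cls q D)) : P x := by
  obtain ⟨y, rfl⟩ := Submodule.Quotient.mk_surjective _ x
  induction y using Finsupp.induction_linear with
  | zero => exact hz
  | add y z hy hz => exact ha _ _ hy hz
  | single D c =>
    obtain ⟨F, rfl⟩ : ∃ F, D = HomT.mk F := (Quot.exists_rep D).imp fun _ h => h.symm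
    have e : Finsupp.single (HomT.mk F) c = c • Finsupp.single (HomT.mk F) (1 : ℂ) := by simp
    rw [e]
    exact hs c _ (hc F)

theorem comp_assoc (q : ℂ) {j k m n : ℕ} (Z : HomS q m n) (Y : HomS q k m) (W : HomS q j k) :
    comp q j m n Z (comp q j k m Y W) = comp q j k n (comp q k m n Z Y) W := by
  induction Z using HomS.induction with
  | hz => simp
  | ha x y hx hy => simp [hx, hy]
  | hs c x hx => simp [hx]
  | hc D =>
  induction Y using HomS.induction with
  | hz => simp
  | ha x y hx hy => simp [hx, hy]
  | hs c x hx => simp [hx]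
  | hc E =>
  induction W using HomS.induction with
  | hz => simp
  | ha x y hx hy => simp [hx, hy]
  | hs c x hx => simp [hx]
  | hc F => simp [comp_cls, Diagram.comp]

theorem comp_one (q : ℂ) {m n : ℕ} (Y : HomS q m n) :
    comp q m m n Y (cls q (.one m)) = Y := by
  induction Y using HomS.induction with
  | hz => simp
  | ha x y hx hy => simp [hx, hy]
  | hs c x hx => simp [hx]
  | hc E => simp [comp_cls, Diagram.comp, Diagram.one]

open Classical in
/-- The class of the diagram with the given word, and `0` if the word does not fit. -/
noncomputable def ev (q : ℂ) (m n : ℕ) (w : List Piece) : HomS q m n :=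
  if h : Fits w m n then cls q ⟨w, h⟩ else 0

theorem cls_eq_ev (q : ℂ) {m n : ℕ} (D : Diagram m n) : cls q D = ev q m n D.word :=
  by
  rw [ev, dif_pos D.fits]

theorem ev_of_not_fits {q : ℂ} {m n : ℕ} {w : List Piece} (h : ¬Fits w m n) : ev q m n w = 0 :=
  dif_neg h

theorem ev_append {q : ℂ} {k m n : ℕ} {A : List Piece} (hA : Fits A k m) (w : List Piece) :
    ev q k n (A ++ w) = comp q k m n (ev q m n w) (ev q k m A) := by
  by_cases hw : Fits w m n
  · rw [← cls_eq_ev q ⟨A, hA⟩, ← cls_eq_ev q ⟨w, hw⟩, comp_cls, cls_eq_ev]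
    rfl
  · rw [ev_of_not_fits hw, ev_of_not_fits]
    · simp
    · rintro h
      obtain ⟨p, hp, h⟩ := fits_append.1 h
      obtain rfl := hA.unique hp
      exact hw h

/-- The hypothesis is vanishing, not a condition on `Fits`: vanishing transfers along `Rel`, whereas
a word that fits may be related to one that does not. -/
theorem ev_append_of_zero {q : ℂ} {k m n : ℕ} {u : List Piece}
    (hu : ∀ r, r ≠ m → ev q k r u = 0) (B : List Piece) :
    ev q k n (u ++ B) = comp q k m n (ev q m n B) (ev q k m u) := by
  by_cases h : ∃ r, Fits u k r
  · obtain ⟨r, hr⟩ := h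
    by_cases hm : r = m
    · subst hm; exact ev_append hr B
    · rw [ev_append hr, hu r hm, ev_of_not_fits (w := u) fun h => hm (hr.unique h)]
      simp
  · rw [ev_of_not_fits (w := u) fun h' => h ⟨_, h'⟩, ev_of_not_fits, map_zero]
    exact fun h' => h ((fits_append.1 h').imp fun _ => And.left)

theorem ev_eq_of_step {q : ℂ} {m n : ℕ} {u v A B : List Piece} {p : ℕ} (hA : Fits A m p)
    (h : Move p u v) (hu : Fits (A ++ u ++ B) m n) (hv : Fits (A ++ v ++ B) m n) :
    ev q m n (A ++ u ++ B) = ev q m n (A ++ v ++ B) := by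
  rw [← cls_eq_ev q ⟨_, hu⟩, ← cls_eq_ev q ⟨_, hv⟩]
  exact congrArg (fun x => Submodule.Quotient.mk (Finsupp.single x 1))
    (Quot.sound ⟨A, B, u, v, p, hA, h, rfl, rfl⟩)

/-! ### Equality of words in the skein as a congruence -/

/-- Two words represent the same element of the skein when they are placed outside of a circle
with `m` strands. -/
def Rel (q : ℂ) (m : ℕ) (u v : List Piece) : Prop := ∀ n, ev q m n u = ev q m n v

namespace Rel

variable {q : ℂ} {m : ℕ} {u v w : List Piece}

theorem refl (q : ℂ) (m : ℕ) (u : List Piece) : Rel q m u u := fun _ => rfl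

theorem of_eq (h : u = v) : Rel q m u v := h ▸ refl q m u

theorem symm (h : Rel q m u v) : Rel q m v u := fun n => (h n).symm

theorem trans (h : Rel q m u v) (h' : Rel q m v w) : Rel q m u w := fun n => (h n).trans (h' n)

theorem append_left (A : List Piece) (h : ∀ p, Fits A m p → Rel q p u v) :
    Rel q m (A ++ u) (A ++ v) := by
  intro n
  by_cases hA : ∃ p, Fits A m p
  · obtain ⟨p, hp⟩ := hA
    rw [ev_append hp, ev_append hp, h p hp n]
  · rw [ev_of_not_fits, ev_of_not_fits] <;>
    exact fun h => hA ((fits_append.1 h).imp fun _ => And.left)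

theorem cons (s : Piece) (h : ∀ p, s.Fits m p → Rel q p u v) : Rel q m (s :: u) (s :: v) :=
  append_left [s] fun p ⟨_, hp, e⟩ => by cases e; exact h p hp

theorem append_right (h : Rel q m u v) (B : List Piece) : Rel q m (u ++ B) (v ++ B) := by
  intro n
  by_cases hu : ∃ r, ev q m r u ≠ 0
  · obtain ⟨r, hr⟩ := hu
    have hf : Fits u m r := by_contra fun h => hr (ev_of_not_fits h)
    have h0 : ∀ r', r' ≠ r → ev q m r' u = 0 := fun r' h' =>
      ev_of_not_fits fun h => h' (h.unique hf)
    rw [ev_append_of_zero h0, ev_append_of_zero fun r' h' => by rw [← h r', h0 r' h'], h r]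
  -- If every evaluation of `u` vanishes, any intermediate number of strands will do; `0` is an
  -- arbitrary choice.
  · push Not at hu
    rw [ev_append_of_zero (m := 0) fun r _ => hu r,
      ev_append_of_zero (m := 0) fun r _ => by rw [← h r, hu r], h 0]

/-- A move alone does not ensure that its two sides fit together: the empty word of `Move.zigzag`
always fits, the other side only if the strand exists. -/
theorem of_move (h : Move m u v) (hf : ∀ n, Fits u m n ↔ Fits v m n) : Rel q m u v := by
  intro n
  by_cases hu : Fits u m n
  · simpa using ev_eq_of_step (q := q) (A := []) (B := []) rfl h (by simpa using hu)
      (by simpa using (hf n).1 hu)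
  · rw [ev_of_not_fits hu, ev_of_not_fits (mt (hf n).2 hu)]

/-- Moving an inverse pair of words to the other sides of a commutative square. -/
theorem conj {p : ℕ} {a a' b b' x y : List Piece} (ha' : ∀ r, Fits a' p r → r = m)
    (h1 : Rel q p (a' ++ a) []) (h2 : ∀ r, Fits x m r → Rel q r (b ++ b') [])
    (h : Rel q m (x ++ b) (a ++ y)) : Rel q p (a' ++ x) (y ++ b') := by
  have e1 : Rel q p (a' ++ (x ++ (b ++ b'))) (a' ++ (x ++ [])) :=
    append_left a' fun r hr => append_left x fun r' hr' => h2 r' (by rwa [← ha' r hr])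
  have e2 : Rel q p (a' ++ ((x ++ b) ++ b')) (a' ++ ((a ++ y) ++ b')) :=
    append_left a' fun r hr => by
      obtain rfl := ha' r hr
      exact h.append_right b'
  have e3 := h1.append_right (y ++ b')
  simp only [List.append_assoc, List.append_nil, List.nil_append] at e1 e2 e3
  exact e1.symm.trans (e2.trans e3)

end Rel

end

open Piece Event

section

/-! ### Skein relations for words -/

theorem fits_event_iff {x : Event} {i m n : ℕ} {w : List Piece} :
    Fits (event x i :: w) m n ↔ i + x.ins ≤ m ∧ Fits w (m - x.ins + x.outs) n := by
  constructor
  · rintro ⟨p, ⟨h1, h2⟩, h3⟩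
    obtain rfl : p = m - x.ins + x.outs := by omega
    exact ⟨h1, h3⟩
  · rintro ⟨h1, h3⟩
    exact ⟨_, ⟨h1, by omega⟩, h3⟩

theorem fits_rot_iff {m n : ℕ} {w : List Piece} :
    Fits (rot :: w) m n ↔ 0 < m ∧ Fits w m n :=
  ⟨fun ⟨_, ⟨h1, h2⟩, h3⟩ => ⟨h1, h2 ▸ h3⟩, fun ⟨h1, h3⟩ => ⟨m, ⟨h1, rfl⟩, h3⟩⟩

theorem fits_rotInv_iff {m n : ℕ} {w : List Piece} :
    Fits (rotInv :: w) m n ↔ 0 < m ∧ Fits w m n :=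
  ⟨fun ⟨_, ⟨h1, h2⟩, h3⟩ => ⟨h1, h2 ▸ h3⟩, fun ⟨h1, h3⟩ => ⟨m, ⟨h1, rfl⟩, h3⟩⟩

theorem fits_nil_iff {m n : ℕ} : Fits [] m n ↔ m = n := Iff.rfl

/-- The coefficient of the radial smoothing of a crossing. -/
noncomputable def kauffmanCoeff (q : ℂ) (o : Bool) : ℂ := if o then q else q⁻¹

/-- Both Kauffman relations in one formula, ordered by the shape of the smoothing, radial first,
instead of by the power of `q`. -/
theorem ev_cross {q : ℂ} {m n p : ℕ} {A : List Piece} (hA : Fits A m p) (o : Bool) {i : ℕ}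
    (hi : i + 2 ≤ p) (B : List Piece) :
    ev q m n (A ++ event (cross o) i :: B) = kauffmanCoeff q o • ev q m n (A ++ B) +
      kauffmanCoeff q (!o) • ev q m n (A ++ event cap i :: event cup i :: B) := by
  have e : p - 2 + 2 = p := by omega
  have h : Fits (A ++ event (cross o) i :: B) m n ↔ Fits (A ++ B) m n := by
    simp only [fits_append, fits_event_iff, ins, outs]
    refine exists_congr fun r => and_congr_right fun hr => ?_
    obtain rfl := hA.unique hr
    simp [e, hi]
  have h' : Fits (A ++ event cap i :: event cup i :: B) m n ↔ Fits (A ++ B) m n := by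
    simp only [fits_append, fits_event_iff, ins, outs]
    refine exists_congr fun r => and_congr_right fun hr => ?_
    obtain rfl := hA.unique hr
    have : i ≤ p - 2 := by omega
    simp [e, hi, this]
  by_cases hf : Fits (A ++ B) m n
  · rw [← cls_eq_ev q ⟨_, hf⟩, ← cls_eq_ev q ⟨_, h.2 hf⟩, ← cls_eq_ev q ⟨_, h'.2 hf⟩]
    cases o
    · rw [add_comm]
      refine (Submodule.Quotient.eq _).2 (Submodule.subset_span ?_)
      exact .kauffmanUnder A B i _ _ _ (by simp) (by simp) rfl
    · refine (Submodule.Quotient.eq _).2 (Submodule.subset_span ?_)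
      exact .kauffmanOver A B i _ _ _ (by simp) rfl (by simp)
  · rw [ev_of_not_fits hf, ev_of_not_fits (mt h.1 hf), ev_of_not_fits (mt h'.1 hf)]
    simp

theorem ev_loop {q : ℂ} {m n p : ℕ} {A : List Piece} (hA : Fits A m p) {i : ℕ}
    (hi : i ≤ p) (B : List Piece) :
    ev q m n (A ++ event cup i :: event cap i :: B) =
      (-(q ^ 2 + (q ^ 2)⁻¹)) • ev q m n (A ++ B) := by
  have h : Fits (A ++ event cup i :: event cap i :: B) m n ↔ Fits (A ++ B) m n := by
    simp only [fits_append, fits_event_iff, ins, outs]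
    refine exists_congr fun r => and_congr_right fun hr => ?_
    obtain rfl := hA.unique hr
    simp [hi]
  by_cases hf : Fits (A ++ B) m n
  · rw [← cls_eq_ev q ⟨_, hf⟩, ← cls_eq_ev q ⟨_, h.2 hf⟩]
    refine (Submodule.Quotient.eq _).2 (Submodule.subset_span ?_)
    exact .loop A B i _ _ (by simp) rfl
  · rw [ev_of_not_fits hf, ev_of_not_fits (mt h.1 hf)]
    simp

variable {q : ℂ} {m : ℕ}

/-- The positions are tied by equations instead of the literal sums in `Move.interchange`, so that
each use reduces to linear arithmetic. -/
theorem rel_interchange {x y : Event} {i j k l : ℕ} (h : i + x.outs ≤ j)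
    (hk : k + x.outs = j + x.ins) (hl : l = i) :
    Rel q m [event x i, event y j] [event y k, event x l] := by
  subst hl
  obtain ⟨d, rfl⟩ := Nat.exists_eq_add_of_le h
  obtain rfl : k = l + x.ins + d := by omega
  refine .of_move (.interchange x y l d) fun n => ?_
  simp only [fits_event_iff, fits_nil_iff]
  omega

theorem rel_zigzag {i : ℕ} (h : i + 1 ≤ m) : Rel q m [event cup (i + 1), event cap i] [] := by
  refine .of_move (.zigzag i) fun n => ?_
  simp only [fits_event_iff, fits_nil_iff, ins, outs]
  omega

theorem rel_zagzig {i : ℕ} (h : i + 1 ≤ m) : Rel q m [event cup i, event cap (i + 1)] [] := by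
  refine .of_move (.zagzig i) fun n => ?_
  simp only [fits_event_iff, fits_nil_iff, ins, outs]
  omega

/-- No bound on `i` is needed: with fewer than `i + 3` strands neither word fits, and both evaluate
to `0`. -/
theorem rel_capSlide (o : Bool) (i : ℕ) :
    Rel q m [event (cross o) (i + 1), event cap i] [event (cross (!o)) i, event cap (i + 1)] := by
  by_cases h : i + 3 ≤ m
  · refine .of_move (.capSlide o i) fun n => ?_
    simp only [fits_event_iff, fits_nil_iff, ins, outs]
    omega
  · intro n
    rw [ev_of_not_fits, ev_of_not_fits] <;>
    · simp only [fits_event_iff, fits_nil_iff, ins, outs]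
      omega

theorem rel_cupSlide (o : Bool) (i : ℕ) :
    Rel q m [event cup i, event (cross o) (i + 1)] [event cup (i + 1), event (cross (!o)) i] := by
  refine .of_move (.cupSlide o i) fun n => ?_
  simp only [fits_event_iff, fits_nil_iff, ins, outs]
  omega

theorem rel_rotCancel (h : 0 < m) : Rel q m [rot, rotInv] [] := by
  refine .of_move .rotCancel fun n => ?_
  simp [fits_rot_iff, fits_rotInv_iff, fits_nil_iff, h]

theorem rel_rotInvCancel (h : 0 < m) : Rel q m [rotInv, rot] [] := by
  refine .of_move .rotInvCancel fun n => ?_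
  simp [fits_rot_iff, fits_rotInv_iff, fits_nil_iff, h]

theorem rel_rotEvent {x : Event} {i : ℕ} (h : i + x.ins < m) :
    Rel q m [event x i, rot] [rot, event x (i + 1)] := by
  refine .of_move (.rotEvent x i h) fun n => ?_
  simp only [fits_event_iff, fits_rot_iff, fits_nil_iff]
  omega

theorem rel_cutEvent {x : Event} {i : ℕ} (h : i + x.ins = m) :
    Rel q m (event x i :: List.replicate x.outs rot)
      (List.replicate x.ins rot ++ [event x 0]) := by
  refine .of_move (.cutEvent x i h) fun n => ?_
  cases x <;> simp [List.replicate, fits_event_iff, fits_rot_iff, fits_nil_iff, ins, outs] at h ⊢ <;>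
    omega

/-- Two crossings of opposite kind cancel. -/
theorem rel_crossCancel (hq : q ≠ 0) (o : Bool) {i : ℕ} (h : i + 2 ≤ m) :
    Rel q m [event (cross o) i, event (cross (!o)) i] [] := by
  intro n
  have hm : m - 2 + 2 = m := by omega
  have e1 := ev_cross (q := q) (n := n) (A := []) (m := m) rfl o h [event (cross (!o)) i]
  have e2 := ev_cross (q := q) (n := n) (A := []) (m := m) rfl (!o) h []
  have e3 := ev_cross (q := q) (n := n) (m := m) (A := [event cap i, event cup i]) (p := m)
    (by simp only [fits_event_iff, fits_nil_iff, ins, outs]; omega) (!o) h []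
  have e4 := ev_loop (q := q) (n := n) (m := m) (A := [event cap i]) (p := m - 2) (i := i)
    (by simp only [fits_event_iff, fits_nil_iff, ins, outs]; omega) (by omega) [event cup i]
  simp only [List.nil_append, List.cons_append] at e1 e2 e3 e4
  rw [e1, e2, e3, e4]
  -- The identity gets the coefficient `q q⁻¹ = 1`. The cap followed by a cup gets `q² + q⁻²` from
  -- two of the states and `-(q² + q⁻²)` from the state with a closed loop.
  cases o <;> simp only [kauffmanCoeff, Bool.not_true, Bool.not_false, if_true,
    Bool.false_eq_true, if_false] <;> match_scalars <;> field_simp <;> ring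

/-- To compare words that contain a crossing, it is enough to compare both smoothings. -/
theorem Rel.of_smoothings {A B A' B' : List Piece} {p p' i j : ℕ} (o : Bool) (hA : Fits A m p)
    (hi : i + 2 ≤ p) (hA' : Fits A' m p') (hj : j + 2 ≤ p')
    (h : Rel q m (A ++ B) (A' ++ B'))
    (h' : Rel q m (A ++ event cap i :: event cup i :: B)
      (A' ++ event cap j :: event cup j :: B')) :
    Rel q m (A ++ event (cross o) i :: B) (A' ++ event (cross o) j :: B') := by
  intro n
  rw [ev_cross hA o hi, ev_cross hA' o hj, h n, h' n]

/-! ### Strands that pass over or under other strands -/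

/-- The strand in position `i` moves to position `i + c`. -/
def passRight (o : Bool) (i c : ℕ) : List Piece :=
  (List.range c).map fun j => event (cross o) (i + j)

/-- The strand in position `i + c` moves to position `i`. -/
def passLeft (o : Bool) (i c : ℕ) : List Piece :=
  (List.range c).reverse.map fun j => event (cross o) (i + j)

@[simp] theorem passRight_zero (o : Bool) (i : ℕ) : passRight o i 0 = [] := rfl

@[simp] theorem passLeft_zero (o : Bool) (i : ℕ) : passLeft o i 0 = [] := rfl

theorem passRight_succ (o : Bool) (i c : ℕ) :
    passRight o i (c + 1) = passRight o i c ++ [event (cross o) (i + c)] := by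
  simp [passRight, List.range_succ]

theorem passRight_succ' (o : Bool) (i c : ℕ) :
    passRight o i (c + 1) = event (cross o) i :: passRight o (i + 1) c := by
  simp only [passRight, List.range_succ_eq_map, List.map_cons, List.map_map, Function.comp_def,
    Nat.succ_eq_add_one, Nat.add_zero, Nat.add_assoc, Nat.add_comm 1]

theorem passRight_add (o : Bool) (i c d : ℕ) :
    passRight o i (c + d) = passRight o i c ++ passRight o (i + c) d := by
  induction d with
  | zero => simp
  | succ d ih => rw [← Nat.add_assoc, passRight_succ, ih, passRight_succ]; simp [Nat.add_assoc]

theorem passLeft_succ (o : Bool) (i c : ℕ) :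
    passLeft o i (c + 1) = event (cross o) (i + c) :: passLeft o i c := by
  simp [passLeft, List.range_succ]

theorem Fits.of_passRight {o : Bool} {i c m n : ℕ} (h : Fits (passRight o i c) m n) : n = m := by
  induction c generalizing n with
  | zero => exact h.symm
  | succ c ih =>
    rw [passRight_succ] at h
    obtain ⟨p, hp, h⟩ := fits_append.1 h
    have := ih hp
    simp only [fits_event_iff, fits_nil_iff, ins, outs] at h
    omega

theorem Fits.of_passLeft {o : Bool} {i c m n : ℕ} (h : Fits (passLeft o i c) m n) : n = m := by
  induction c generalizing m with
  | zero => exact h.symm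
  | succ c ih =>
    rw [passLeft_succ, fits_event_iff] at h
    simp only [ins, outs] at h
    have := ih h.2
    omega

theorem rel_passRight_passLeft (hq : q ≠ 0) (o : Bool) {i c : ℕ} (h : i + c + 1 ≤ m) :
    Rel q m (passRight o i c ++ passLeft (!o) i c) [] := by
  induction c with
  | zero => exact .refl _ _ _
  | succ c ih =>
    rw [passRight_succ, passLeft_succ]
    have e : Rel q m (passRight o i c ++ ([event (cross o) (i + c), event (cross (!o)) (i + c)] ++
        passLeft (!o) i c)) (passRight o i c ++ ([] ++ passLeft (!o) i c)) :=
      .append_left _ fun p hp => .append_right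
        (rel_crossCancel hq o (by have := hp.of_passRight; omega)) _
    simpa using e.trans (ih (by omega))

theorem rel_passLeft_passRight (hq : q ≠ 0) (o : Bool) {i c : ℕ} (h : i + c + 1 ≤ m) :
    Rel q m (passLeft o i c ++ passRight (!o) i c) [] := by
  induction c with
  | zero => exact .refl _ _ _
  | succ c ih =>
    rw [passRight_succ, passLeft_succ]
    have e : Rel q m ([event (cross o) (i + c)] ++ ((passLeft o i c ++ passRight (!o) i c) ++
        [event (cross (!o)) (i + c)])) ([event (cross o) (i + c)] ++ ([] ++
        [event (cross (!o)) (i + c)])) :=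
      .append_left _ fun p hp => .append_right
        (by
          simp only [fits_event_iff, fits_nil_iff, ins, outs] at hp
          obtain rfl : m = p := by omega
          exact ih (by omega)) _
    simpa using e.trans (rel_crossCancel hq o (by omega))

/-- An event happens before or after a strand passes at larger angles. -/
theorem rel_event_passRight {x : Event} {o : Bool} {i j k c : ℕ} (h : i + x.outs ≤ j)
    (hk : k + x.outs = j + x.ins) :
    Rel q m (event x i :: passRight o j c) (passRight o k c ++ [event x i]) := by
  induction c with
  | zero => exact .refl _ _ _
  | succ c ih =>
    rw [passRight_succ, passRight_succ]
    have e1 := ih.append_right [event (cross o) (j + c)]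
    have e2 : Rel q m (passRight o k c ++ [event x i, event (cross o) (j + c)])
        (passRight o k c ++ [event (cross o) (k + c), event x i]) :=
      .append_left _ fun p _ => rel_interchange (by omega) (by omega) rfl
    simp only [List.append_assoc, List.cons_append, List.nil_append] at e1 e2 ⊢
    exact e1.trans e2

/-- An event happens before or after a strand passes at smaller angles. -/
theorem rel_passRight_event {x : Event} {o : Bool} {i j c : ℕ} (h : i + c + 1 ≤ j) :
    Rel q m (passRight o i c ++ [event x j]) (event x j :: passRight o i c) := by
  induction c with
  | zero => exact .refl _ _ _
  | succ c ih =>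
    rw [passRight_succ]
    have e1 := (ih (by omega)).append_right [event (cross o) (i + c)]
    have e2 : Rel q m (passRight o i c ++ [event (cross o) (i + c), event x j])
        (passRight o i c ++ [event x j, event (cross o) (i + c)]) :=
      .append_left _ fun p _ => rel_interchange (by simp only [outs]; omega)
        (by simp [ins, outs]) rfl
    simp only [List.append_assoc, List.cons_append, List.nil_append] at e1 e2 ⊢
    exact e2.trans e1

theorem rel_passRight_passRight {o o' : Bool} {i j c d : ℕ} (h : i + c + 1 ≤ j) :
    Rel q m (passRight o i c ++ passRight o' j d) (passRight o' j d ++ passRight o i c) := by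
  induction d with
  | zero => exact .of_eq (by simp)
  | succ d ih =>
    rw [passRight_succ]
    have e1 := ih.append_right [event (cross o') (j + d)]
    have e2 : Rel q m (passRight o' j d ++ (passRight o i c ++ [event (cross o') (j + d)]))
        (passRight o' j d ++ (event (cross o') (j + d) :: passRight o i c)) :=
      .append_left _ fun p _ => rel_passRight_event (by omega)
    simp only [List.append_assoc, List.cons_append, List.nil_append] at e1 e2 ⊢
    exact e1.trans e2

/-- A strand passes an event clockwise. -/
theorem rel_event_passLeft (hq : q ≠ 0) (x : Event) (o : Bool) {i : ℕ} (h : i + x.ins + 1 ≤ m) :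
    Rel q m (event x i :: passLeft o i x.outs) (passLeft o i x.ins ++ [event x (i + 1)]) := by
  -- A strand is pulled off an arc: one crossing slides over the extremum, changes its kind, and
  -- cancels the other.
  have hcup : ∀ {m} (i : ℕ), i + 1 ≤ m →
      Rel q m [event cup i, event (cross o) (i + 1), event (cross o) i] [event cup (i + 1)] := by
    intro m i h
    have e1 := (rel_cupSlide (q := q) (m := m) o i).append_right [event (cross o) i]
    have e2 : Rel q m [event cup (i + 1), event (cross (!o)) i, event (cross o) i]
        [event cup (i + 1)] :=
      .cons _ fun p hp => by
        simp only [Piece.Fits, ins, outs] at hp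
        simpa using rel_crossCancel hq (!o) (m := p) (i := i) (by omega)
    exact e1.trans e2
  have hcap : ∀ {m} (i : ℕ), i + 3 ≤ m →
      Rel q m [event (cross o) (i + 1), event (cross o) i, event cap (i + 1)] [event cap i] := by
    intro m i h
    have e1 : Rel q m [event (cross o) (i + 1), event (cross o) i, event cap (i + 1)]
        [event (cross o) (i + 1), event (cross (!o)) (i + 1), event cap i] :=
      .cons _ fun p hp => by
        simpa using (rel_capSlide (q := q) (m := p) (!o) i).symm
    exact e1.trans ((rel_crossCancel hq o (by omega)).append_right [event cap i])
  cases x with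
  | cup => exact hcup i h
  | cap => exact (hcap i h).symm
  | cross o' =>
    simp only [ins] at h
    -- Reidemeister III: the crossing `x`, not one of the moving strand, is smoothed. The radial
    -- smoothing leaves nothing to pass; the other is a cap and a cup, passed by `hcap` and `hcup`.
    refine Rel.of_smoothings (A := []) (B' := []) (A' := passLeft o i 2) (p := m) (p' := m) o' rfl
      (by omega) ?_ (by omega) ?_ ?_
    · simp only [passLeft_succ, passLeft_zero, fits_event_iff, fits_nil_iff, ins, outs]; omega
    · exact .of_eq (by simp [outs])
    · refine Rel.trans (v := [event cap i, event cup (i + 1)]) (.cons _ fun p hp => ?_) ?_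
      · simp only [Piece.Fits, ins, outs] at hp
        exact hcup i (by omega)
      · exact ((hcap i h).append_right [event cup (i + 1)]).symm

/-- A strand passes an event counterclockwise. -/
theorem rel_event_passRight_self (hq : q ≠ 0) (x : Event) (o : Bool) {i : ℕ}
    (h : i + x.ins + 1 ≤ m) :
    Rel q m (event x (i + 1) :: passRight o i x.outs) (passRight o i x.ins ++ [event x i]) := by
  -- The inverse of passing counterclockwise with `o` is passing clockwise with `!o`, so the
  -- clockwise statement for `!o` is conjugated.
  have e := Rel.conj (q := q) (p := m) (a' := passRight o i x.ins) (a := passLeft (!o) i x.ins)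
    (b := passLeft (!o) i x.outs) (b' := passRight o i x.outs) (x := [event x i])
    (y := [event x (i + 1)]) (fun r hr => hr.of_passRight) (rel_passRight_passLeft hq o h)
    (fun r hr => by
      simp only [fits_event_iff, fits_nil_iff] at hr
      simpa using rel_passLeft_passRight hq (!o) (m := r) (i := i) (c := x.outs) (by omega))
    (rel_event_passLeft hq x (!o) h)
  exact e.symm

/-- A strand passes an event and other strands counterclockwise. -/
theorem rel_event_passRight_all (hq : q ≠ 0) (x : Event) (o : Bool) {i j c d : ℕ}
    (hj : i ≤ j) (hd : j + x.outs ≤ i + d) (hc : c + x.outs = d + x.ins) (hm : i + c + 1 ≤ m) :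
    Rel q m (event x (j + 1) :: passRight o i d) (passRight o i c ++ [event x j]) := by
  -- The moving strand passes `a` strands before the event, those of the event, and `b` strands
  -- after it.
  obtain ⟨a, rfl⟩ := Nat.exists_eq_add_of_le hj
  obtain ⟨b, rfl⟩ : ∃ b, d = a + x.outs + b := ⟨d - (a + x.outs), by omega⟩
  obtain rfl : c = a + x.ins + b := by omega
  simp only [passRight_add]
  have e1 : Rel q m (event x (i + a + 1) :: passRight o i a)
      (passRight o i a ++ [event x (i + a + 1)]) := (rel_passRight_event (by omega)).symm
  have e2 : Rel q m (passRight o i a ++ event x (i + a + 1) :: passRight o (i + a) x.outs)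
      (passRight o i a ++ (passRight o (i + a) x.ins ++ [event x (i + a)])) :=
    .append_left _ fun p hp => by
      have := hp.of_passRight
      exact rel_event_passRight_self hq x o (by omega)
  have e3 : Rel q m (passRight o i a ++ (passRight o (i + a) x.ins ++
        event x (i + a) :: passRight o (i + (a + x.outs)) b))
      (passRight o i a ++ (passRight o (i + a) x.ins ++
        (passRight o (i + (a + x.ins)) b ++ [event x (i + a)]))) :=
    .append_left _ fun p _ => .append_left _ fun p _ => rel_event_passRight (by omega) (by omega)
  have e1' := e1.append_right (passRight o (i + a) x.outs ++ passRight o (i + (a + x.outs)) b)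
  have e2' := e2.append_right (passRight o (i + (a + x.outs)) b)
  simp only [List.append_assoc, List.cons_append, List.nil_append] at e1' e2' e3 ⊢
  exact e1'.trans (e2'.trans e3)

/-- The strict bound keeps the crossings away from the last strand, the one that goes through the
cut. -/
theorem rel_passRight_rot {o : Bool} {i c : ℕ} (h : i + c + 1 < m) :
    Rel q m (passRight o i c ++ [rot]) (rot :: passRight o (i + 1) c) := by
  induction c with
  | zero => exact .refl _ _ _
  | succ c ih =>
    rw [passRight_succ, passRight_succ]
    have e1 := (ih (by omega)).append_right [event (cross o) (i + 1 + c)]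
    have e2 : Rel q m (passRight o i c ++ [event (cross o) (i + c), rot])
        (passRight o i c ++ [rot, event (cross o) (i + c + 1)]) :=
      .append_left _ fun p hp => rel_rotEvent (by
        have := hp.of_passRight
        simp only [ins]; omega)
    rw [Nat.add_right_comm] at e1 ⊢
    simp only [List.append_assoc, List.cons_append, List.nil_append] at e1 e2 ⊢
    exact e2.trans e1

/-- The `c` strands from position `i + w` on move clockwise by `w` positions. -/
def passBlock (o : Bool) (w i : ℕ) : ℕ → List Piece
  | 0 => []
  | c + 1 => passBlock o w i c ++ passLeft o (i + c) w

theorem Fits.of_passBlock {o : Bool} {w i c m n : ℕ} (h : Fits (passBlock o w i c) m n) :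
    n = m := by
  induction c generalizing n with
  | zero => exact h.symm
  | succ c ih =>
    obtain ⟨p, hp, h⟩ := fits_append.1 h
    exact h.of_passLeft.trans (ih hp)

theorem passBlock_zero (o : Bool) (i c : ℕ) : passBlock o 0 i c = [] := by
  induction c with
  | zero => rfl
  | succ c ih => rw [passBlock, ih]; rfl

/-- The same crossings in two orders, related by exchanging crossings at disjoint positions. Two
strands that go through the cut produce crossings grouped by these strands, but an event is slid
past the added strands one at a time, which needs them grouped by the added strands. -/
theorem rel_passBlock_two (o : Bool) (i c : ℕ) :
    Rel q m (passRight o (i + 1) c ++ passRight o i c) (passBlock o 2 i c) := by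
  induction c with
  | zero => exact .refl _ _ _
  | succ c ih =>
    rw [passRight_succ, passRight_succ, passBlock]
    have e1 : Rel q m (passRight o (i + 1) c ++ (event (cross o) (i + 1 + c) :: passRight o i c))
        (passRight o (i + 1) c ++ (passRight o i c ++ [event (cross o) (i + 1 + c)])) :=
      .append_left _ fun p _ => (rel_passRight_event (by omega)).symm
    have e1' := e1.append_right [event (cross o) (i + c)]
    have e2 := ih.append_right [event (cross o) (i + c + 1), event (cross o) (i + c)]
    rw [Nat.add_right_comm] at e1'
    rw [Nat.add_right_comm]
    simp only [List.append_assoc, List.cons_append, List.nil_append, passLeft_succ,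
      passLeft_zero] at e1' e2 ⊢
    exact e1'.trans e2

theorem rel_event_passBlock (hq : q ≠ 0) (x : Event) (o : Bool) {i c : ℕ}
    (h : i + x.ins + c ≤ m) :
    Rel q m (event x i :: passBlock o x.outs i c) (passBlock o x.ins i c ++ [event x (i + c)]) := by
  induction c with
  | zero => exact .refl _ _ _
  | succ c ih =>
    have e1 := (ih (by omega)).append_right (passLeft o (i + c) x.outs)
    have e2 : Rel q m (passBlock o x.ins i c ++ event x (i + c) :: passLeft o (i + c) x.outs)
        (passBlock o x.ins i c ++ (passLeft o (i + c) x.ins ++ [event x (i + c + 1)])) :=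
      .append_left _ fun p hp => by
        have := hp.of_passBlock
        exact rel_event_passLeft hq x o (by omega)
    simp only [List.append_assoc, List.cons_append, List.nil_append, passBlock] at e1 e2 ⊢
    exact e1.trans e2

end

section

/-! ### Additional strands -/

theorem addRight_event (c p : ℕ) (e : Event) (i : ℕ) (w : List Piece) :
    addRight c p (event e i :: w) = event e i :: addRight c (p - e.ins + e.outs) w := rfl

theorem addRight_rot (c p : ℕ) (w : List Piece) :
    addRight c p (rot :: w) = passRight true (p - 1) c ++ rot :: addRight c p w := rfl

theorem addRight_rotInv (c p : ℕ) (w : List Piece) :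
    addRight c p (rotInv :: w) = rotInv :: (passLeft false (p - 1) c ++ addRight c p w) := rfl

theorem addLeft_event (c : ℕ) (e : Event) (i : ℕ) (w : List Piece) :
    addLeft c (event e i :: w) = event e (c + i) :: addLeft c w := rfl

theorem addLeft_rot (c : ℕ) (w : List Piece) :
    addLeft c (rot :: w) = rot :: (passRight false 0 c ++ addLeft c w) := by
  simp only [addLeft, passRight, Nat.zero_add]

theorem addLeft_rotInv (c : ℕ) (w : List Piece) :
    addLeft c (rotInv :: w) = passLeft true 0 c ++ rotInv :: addLeft c w := by
  simp only [addLeft, passLeft, Nat.zero_add]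

theorem addLeft_nil (c : ℕ) : addLeft c [] = [] := rfl

theorem addRight_nil (c p : ℕ) : addRight c p [] = [] := rfl

theorem addLeft_append (c : ℕ) (v w : List Piece) :
    addLeft c (v ++ w) = addLeft c v ++ addLeft c w := by
  induction v with
  | nil => rfl
  | cons s v ih => cases s <;> simp [addLeft, ih]

theorem addRight_append (c : ℕ) {v : List Piece} {k m : ℕ} (h : Fits v k m) (w : List Piece) :
    addRight c k (v ++ w) = addRight c k v ++ addRight c m w := by
  induction v generalizing k with
  | nil => cases h; rfl
  | cons s v ih =>
    cases s with
    | event e i =>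
      rw [fits_event_iff] at h
      simp [addRight_event, ih h.2]
    | rot =>
      rw [fits_rot_iff] at h
      simp [addRight_rot, ih h.2]
    | rotInv =>
      rw [fits_rotInv_iff] at h
      simp [addRight_rotInv, ih h.2]

theorem addLeft_zero (w : List Piece) : addLeft 0 w = w := by
  induction w with
  | nil => rfl
  | cons s w ih => cases s <;> simp [addLeft, ih]

theorem addRight_zero (p : ℕ) (w : List Piece) : addRight 0 p w = w := by
  induction w generalizing p with
  | nil => rfl
  | cons s w ih => cases s <;> simp [addRight, ih]

theorem addLeft_passLeft (c d : ℕ) (o : Bool) (i : ℕ) :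
    addLeft c (passLeft o i d) = passLeft o (c + i) d := by
  induction d with
  | zero => rfl
  | succ d ih => simp [passLeft_succ, addLeft_event, ih, Nat.add_assoc]

theorem addLeft_passRight (c d : ℕ) (o : Bool) (i : ℕ) :
    addLeft c (passRight o i d) = passRight o (c + i) d := by
  induction d with
  | zero => rfl
  | succ d ih => simp [passRight_succ, addLeft_append, addLeft, ih, Nat.add_assoc]

theorem addRight_passRight_append (c p d : ℕ) (o : Bool) (i : ℕ) (h : i + d + 1 ≤ p)
    (w : List Piece) :
    addRight c p (passRight o i d ++ w) = passRight o i d ++ addRight c p w := by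
  induction d generalizing i with
  | zero => rfl
  | succ d ih =>
    have e : p - 2 + 2 = p := by omega
    simp only [passRight_succ', addRight_event, List.cons_append, ins, outs, e]
    rw [ih _ (by omega)]

theorem addRight_passLeft_append (c p d : ℕ) (o : Bool) (i : ℕ) (h : i + d + 1 ≤ p)
    (w : List Piece) :
    addRight c p (passLeft o i d ++ w) = passLeft o i d ++ addRight c p w := by
  induction d with
  | zero => rfl
  | succ d ih =>
    have e : p - 2 + 2 = p := by omega
    simp only [passLeft_succ, addRight_event, List.cons_append, ins, outs, e]
    rw [ih (by omega)]

theorem passLeft_add (o : Bool) (i c d : ℕ) :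
    passLeft o i (c + d) = passLeft o (i + c) d ++ passLeft o i c := by
  induction d with
  | zero => simp
  | succ d ih => rw [← Nat.add_assoc, passLeft_succ, ih, passLeft_succ]; simp [Nat.add_assoc]

/-- This and the next two lemmas are equalities of words; because of them the associativity of the
relative skein product needs no isotopy. -/
theorem addLeft_addLeft (c d : ℕ) (w : List Piece) :
    addLeft c (addLeft d w) = addLeft (c + d) w := by
  induction w with
  | nil => rfl
  | cons s w ih =>
    cases s with
    | event e i => simp [addLeft_event, ih, Nat.add_assoc]
    | rot =>
      simp [addLeft_rot, addLeft_append, addLeft_passRight, ih, passRight_add]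
    | rotInv =>
      simp [addLeft_rotInv, addLeft_append, addLeft_passLeft, ih, passLeft_add]

theorem addRight_addRight (c d : ℕ) {w : List Piece} {m n : ℕ} (h : Fits w m n) :
    addRight c (m + d) (addRight d m w) = addRight (d + c) m w := by
  induction w generalizing m with
  | nil => rfl
  | cons s w ih =>
    cases s with
    | event e i =>
      rw [fits_event_iff] at h
      have e : m + d - e.ins + e.outs = m - e.ins + e.outs + d := by omega
      simp [addRight_event, e, ih h.2]
    | rot =>
      rw [fits_rot_iff] at h
      have e : m + d - 1 = m - 1 + d := by omega
      rw [addRight_rot, addRight_passRight_append _ _ _ _ _ (by omega)]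
      simp [addRight_rot, ih h.2, passRight_add, e]
    | rotInv =>
      rw [fits_rotInv_iff] at h
      have e : m + d - 1 = m - 1 + d := by omega
      rw [addRight_rotInv, addRight_rotInv, addRight_passLeft_append _ _ _ _ _ (by omega)]
      simp [addRight_rotInv, ih h.2, passLeft_add, e]

theorem addLeft_addRight (c d : ℕ) {w : List Piece} {m n : ℕ} (h : Fits w m n) :
    addRight d (c + m) (addLeft c w) = addLeft c (addRight d m w) := by
  induction w generalizing m with
  | nil => rfl
  | cons s w ih =>
    cases s with
    | event e i =>
      rw [fits_event_iff] at h
      have e : c + m - e.ins + e.outs = c + (m - e.ins + e.outs) := by omega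
      simp [addRight_event, addLeft_event, e, ih h.2]
    | rot =>
      rw [fits_rot_iff] at h
      have e : c + m - 1 = c + (m - 1) := by omega
      rw [addLeft_rot, addRight_rot, addRight_rot, addRight_passRight_append _ _ _ _ _ (by omega)]
      simp [addLeft_append, addLeft_passRight, addLeft_rot, ih h.2, e]
    | rotInv =>
      rw [fits_rotInv_iff] at h
      have e : c + m - 1 = c + (m - 1) := by omega
      rw [addLeft_rotInv, addRight_rotInv, addRight_passLeft_append _ _ _ _ _ (by omega)]
      simp [addLeft_append, addRight_rotInv, addLeft_passLeft, addLeft_rotInv, ih h.2, e]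

/-! ### Planar isotopies in the presence of added strands -/

variable {q : ℂ} {m : ℕ}

theorem rel_addRight_rotCancel (hq : q ≠ 0) (c : ℕ) {p : ℕ} (h : 0 < p) :
    Rel q (p + c) (addRight c p [rot] ++ addRight c p [rotInv]) [] := by
  have e1 : Rel q (p + c) (passRight true (p - 1) c ++ ([rot, rotInv] ++ passLeft false (p - 1) c))
      (passRight true (p - 1) c ++ ([] ++ passLeft false (p - 1) c)) :=
    .append_left _ fun r hr => .append_right (rel_rotCancel (by have := hr.of_passRight; omega)) _
  have e2 := rel_passRight_passLeft hq true (m := p + c) (i := p - 1) (c := c) (by omega)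
  simpa [addRight_rot, addRight_rotInv, addRight_nil] using e1.trans e2

theorem rel_addRight_rotInvCancel (hq : q ≠ 0) (c : ℕ) {p : ℕ} (h : 0 < p) :
    Rel q (p + c) (addRight c p [rotInv] ++ addRight c p [rot]) [] := by
  have e1 : Rel q (p + c)
      ([rotInv] ++ ((passLeft false (p - 1) c ++ passRight true (p - 1) c) ++ [rot]))
      ([rotInv] ++ ([] ++ [rot])) :=
    .append_left _ fun r hr => .append_right (by
      simp only [fits_rotInv_iff, fits_nil_iff] at hr
      exact rel_passLeft_passRight hq false (by omega)) _
  simpa [addRight_rot, addRight_rotInv, addRight_nil] using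
    e1.trans (rel_rotInvCancel (m := p + c) (by omega))

theorem rel_addLeft_rotCancel (hq : q ≠ 0) (c : ℕ) {p : ℕ} (h : 0 < p) :
    Rel q (c + p) (addLeft c [rot] ++ addLeft c [rotInv]) [] := by
  have e1 : Rel q (c + p)
      ([rot] ++ ((passRight false 0 c ++ passLeft true 0 c) ++ [rotInv]))
      ([rot] ++ ([] ++ [rotInv])) :=
    .append_left _ fun r hr => .append_right (by
      simp only [fits_rot_iff, fits_nil_iff] at hr
      exact rel_passRight_passLeft hq false (by omega)) _
  simpa [addLeft_rot, addLeft_rotInv, addLeft_nil] using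
    e1.trans (rel_rotCancel (m := c + p) (by omega))

theorem rel_addLeft_rotInvCancel (hq : q ≠ 0) (c : ℕ) {p : ℕ} (h : 0 < p) :
    Rel q (c + p) (addLeft c [rotInv] ++ addLeft c [rot]) [] := by
  have e1 : Rel q (c + p) (passLeft true 0 c ++ ([rotInv, rot] ++ passRight false 0 c))
      (passLeft true 0 c ++ ([] ++ passRight false 0 c)) :=
    .append_left _ fun r hr => .append_right (rel_rotInvCancel (by have := hr.of_passLeft; omega)) _
  have e2 := rel_passLeft_passRight hq true (m := c + p) (i := 0) (c := c) (by omega)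
  simpa [addLeft_rot, addLeft_rotInv, addLeft_nil] using e1.trans e2

/-- The last `w` of the strands that are not added pass through the cut. -/
theorem rel_addRight_rots (c : ℕ) {i w : ℕ} (hw : w = 0 ∨ w = 2) :
    Rel q (i + w + c) (addRight c (i + w) (List.replicate w rot))
      (passBlock true w i c ++ List.replicate w rot) := by
  obtain rfl | rfl := hw
  · exact .of_eq (by simp [passBlock_zero, addRight_nil])
  · have e1 : Rel q (i + 2 + c)
        (passRight true (i + 1) c ++ (rot :: passRight true (i + 1) c))
        (passRight true (i + 1) c ++ (passRight true i c ++ [rot])) :=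
      .append_left _ fun p hp => (rel_passRight_rot (by have := hp.of_passRight; omega)).symm
    have e1' := e1.append_right [rot]
    have e2 := (rel_passBlock_two (q := q) (m := i + 2 + c) true i c).append_right [rot, rot]
    simp only [List.append_assoc, List.cons_append, List.nil_append] at e1' e2
    exact e1'.trans e2

/-- The last `w` of the strands that are not added pass through the cut. -/
theorem rel_addLeft_rots (c : ℕ) {i w : ℕ} (hw : w = 0 ∨ w = 2) :
    Rel q (c + (i + w)) (addLeft c (List.replicate w rot))
      (List.replicate w rot ++ passBlock false w 0 c) := by
  obtain rfl | rfl := hw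
  · exact .of_eq (by simp [passBlock_zero, addLeft_nil])
  · have e1 : Rel q (c + (i + 2)) (rot :: ((passRight false 0 c ++ [rot]) ++ passRight false 0 c))
        (rot :: ((rot :: passRight false 1 c) ++ passRight false 0 c)) :=
      .cons _ fun p hp => .append_right (rel_passRight_rot (by
        simp only [Piece.Fits] at hp; omega)) _
    have e2 : Rel q (c + (i + 2)) ([rot, rot] ++ (passRight false 1 c ++ passRight false 0 c))
        ([rot, rot] ++ passBlock false 2 0 c) :=
      .append_left _ fun p _ => rel_passBlock_two false 0 c
    simp only [List.append_assoc, List.cons_append, List.nil_append] at e1 e2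
    simpa [List.replicate, addLeft_rot, addLeft_nil] using e1.trans e2

theorem Event.ins_eq (x : Event) : x.ins = 0 ∨ x.ins = 2 := by cases x <;> simp [ins]

theorem Event.outs_eq (x : Event) : x.outs = 0 ∨ x.outs = 2 := by cases x <;> simp [outs]

theorem Fits.of_replicate_rot {w m n : ℕ} (h : Fits (List.replicate w rot) m n) : n = m := by
  induction w with
  | zero => exact h.symm
  | succ w ih => exact ih (fits_rot_iff.1 h).2

theorem fits_replicate_rot {w m : ℕ} (h : 0 < m) : Fits (List.replicate w rot) m m := by
  induction w with
  | zero => rfl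
  | succ w ih => exact fits_rot_iff.2 ⟨h, ih⟩

/-- A `rot` does not fit on zero strands, so `addRight_append` does not cover `p = 0`; there the
list must be empty. -/
theorem addRight_replicate_rot_append (c w p : ℕ) (h : 0 < p ∨ w = 0) (v : List Piece) :
    addRight c p (List.replicate w rot ++ v) =
      addRight c p (List.replicate w rot) ++ addRight c p v := by
  obtain h | rfl := h
  · exact addRight_append c (fits_replicate_rot h) v
  · rfl

/-- Planar isotopies of a diagram extend to the diagram with radial strands below it. -/
theorem Move.rel_addRight (hq : q ≠ 0) (c : ℕ) {u v : List Piece} {n : ℕ} (h : Move m u v)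
    (hu : Fits u m n) : Rel q (m + c) (addRight c m u) (addRight c m v) := by
  cases h with
  | interchange x y i d => exact rel_interchange (by omega) (by omega) rfl
  | zigzag i =>
    simp only [fits_event_iff, ins, outs] at hu
    exact rel_zigzag (by omega)
  | zagzig i =>
    simp only [fits_event_iff, ins, outs] at hu
    exact rel_zagzig (by omega)
  | capSlide o i => exact rel_capSlide o i
  | cupSlide o i => exact rel_cupSlide o i
  | rotCancel =>
    have := rel_addRight_rotCancel hq c (fits_rot_iff.1 hu).1
    simpa [addRight_rot, addRight_rotInv, addRight_nil] using this
  | rotInvCancel =>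
    have := rel_addRight_rotInvCancel hq c (fits_rotInv_iff.1 hu).1
    simpa [addRight_rot, addRight_rotInv, addRight_nil] using this
  | rotEvent x i h =>
    have e1 : Rel q (m + c) ((event x i :: passRight true (m - x.ins + x.outs - 1) c) ++ [rot])
        ((passRight true (m - 1) c ++ [event x i]) ++ [rot]) :=
      .append_right (rel_event_passRight (by omega) (by omega)) _
    have e2 : Rel q (m + c) (passRight true (m - 1) c ++ [event x i, rot])
        (passRight true (m - 1) c ++ [rot, event x (i + 1)]) :=
      .append_left _ fun p hp => rel_rotEvent (by have := hp.of_passRight; omega)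
    simp only [List.append_assoc, List.cons_append, List.nil_append] at e1 e2
    exact e1.trans e2
  | cutEvent x i h =>
    subst h
    rw [addRight_event, addRight_replicate_rot_append _ _ _ (by have := x.ins_eq; omega),
      Nat.add_sub_cancel]
    -- The crossings caused by the cut are collected into a block. The event slides through the
    -- block to the very last positions, goes through the cut there, and the remaining block is
    -- turned back into crossings of single strands.
    have e1 : Rel q (i + x.ins + c)
        (event x i :: addRight c (i + x.outs) (List.replicate x.outs rot))
        (event x i :: (passBlock true x.outs i c ++ List.replicate x.outs rot)) :=
      .cons _ fun p hp => by
        obtain rfl : p = i + x.outs + c := by simp only [Piece.Fits] at hp; omega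
        exact rel_addRight_rots c x.outs_eq
    have e2 := (rel_event_passBlock hq x true (m := i + x.ins + c) (i := i) (c := c)
      (by omega)).append_right (List.replicate x.outs rot)
    have e3 : Rel q (i + x.ins + c)
        (passBlock true x.ins i c ++ event x (i + c) :: List.replicate x.outs rot)
        (passBlock true x.ins i c ++ (List.replicate x.ins rot ++ [event x 0])) :=
      .append_left _ fun p hp => rel_cutEvent (by have := hp.of_passBlock; omega)
    have e4 := (rel_addRight_rots (q := q) c (i := i) x.ins_eq).append_right [event x 0]
    simp only [List.append_assoc, List.cons_append, List.nil_append] at e1 e2 e3 e4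
    exact e1.trans (e2.trans (e3.trans e4.symm))

/-- Planar isotopies of a diagram extend to the diagram with radial strands above it. -/
theorem Move.rel_addLeft (hq : q ≠ 0) (c : ℕ) {u v : List Piece} {n : ℕ} (h : Move m u v)
    (hu : Fits u m n) : Rel q (c + m) (addLeft c u) (addLeft c v) := by
  cases h with
  | interchange x y i d => exact rel_interchange (by omega) (by omega) rfl
  | zigzag i =>
    simp only [fits_event_iff, ins, outs] at hu
    exact rel_zigzag (i := c + i) (by omega)
  | zagzig i =>
    simp only [fits_event_iff, ins, outs] at hu
    exact rel_zagzig (i := c + i) (by omega)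
  | capSlide o i => exact rel_capSlide o (c + i)
  | cupSlide o i => exact rel_cupSlide o (c + i)
  | rotCancel =>
    have := rel_addLeft_rotCancel hq c (fits_rot_iff.1 hu).1
    simpa [addLeft_rot, addLeft_rotInv, addLeft_nil] using this
  | rotInvCancel =>
    have := rel_addLeft_rotInvCancel hq c (fits_rotInv_iff.1 hu).1
    simpa [addLeft_rot, addLeft_rotInv, addLeft_nil] using this
  | rotEvent x i h =>
    have e1 := (rel_rotEvent (q := q) (m := c + m) (x := x) (i := c + i) (by omega)).append_right
      (passRight false 0 c)
    have e2 : Rel q (c + m) (rot :: event x (c + i + 1) :: passRight false 0 c)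
        (rot :: (passRight false 0 c ++ [event x (c + i + 1)])) :=
      .cons _ fun p _ => (rel_passRight_event (by omega)).symm
    simpa [addLeft_event, addLeft_rot, addLeft_nil, Nat.add_assoc] using e1.trans e2
  | cutEvent x i h =>
    subst h
    rw [addLeft_event, addLeft_append]
    have e1 : Rel q (c + (i + x.ins))
        (event x (c + i) :: addLeft c (List.replicate x.outs rot))
        (event x (c + i) :: (List.replicate x.outs rot ++ passBlock false x.outs 0 c)) :=
      .cons _ fun p hp => by
        obtain rfl : p = c + (i + x.outs) := by simp only [Piece.Fits] at hp; omega
        exact rel_addLeft_rots c x.outs_eq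
    have e2 := (rel_cutEvent (q := q) (m := c + (i + x.ins)) (x := x) (i := c + i)
      (by omega)).append_right (passBlock false x.outs 0 c)
    have e3 : Rel q (c + (i + x.ins))
        (List.replicate x.ins rot ++ event x 0 :: passBlock false x.outs 0 c)
        (List.replicate x.ins rot ++ (passBlock false x.ins 0 c ++ [event x (0 + c)])) :=
      .append_left _ fun p hp => rel_event_passBlock hq x false (by
        have := hp.of_replicate_rot
        omega)
    have e4 := (rel_addLeft_rots (q := q) c (i := i) x.ins_eq).append_right [event x c]
    simp only [List.append_assoc, List.cons_append, List.nil_append, Nat.zero_add] at e1 e2 e3 e4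
    exact e1.trans (e2.trans (e3.trans e4.symm))

end

/-! ### The interchange law -/

theorem fits_singleton {s : Piece} {m n : ℕ} : Fits [s] m n ↔ s.Fits m n :=
  ⟨fun ⟨_, h, e⟩ => e ▸ h, fun h => ⟨n, h, rfl⟩⟩

theorem addLeft_cons (c : ℕ) (t : Piece) (w : List Piece) :
    addLeft c (t :: w) = addLeft c [t] ++ addLeft c w := addLeft_append c [t] w

theorem addRight_cons (c : ℕ) {s : Piece} {k m : ℕ} (h : s.Fits k m) (w : List Piece) :
    addRight c k (s :: w) = addRight c k [s] ++ addRight c m w :=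
  addRight_append c (fits_singleton.2 h) w

/-- With strands added, `rotInv` is still inverse to `rot`, so its commutation follows by
conjugation and only `rot` has to be treated by hand. -/
theorem Rel.commute_rotInv_right {q : ℂ} (hq : q ≠ 0) {a a' b : ℕ} {s : Piece}
    (hs : s.Fits a a') (hb : 0 < b)
    (h : Rel q (a + b) (addRight b a [s] ++ addLeft a' [rot]) (addLeft a [rot] ++ addRight b a [s])) :
    Rel q (a + b) (addRight b a [s] ++ addLeft a' [rotInv])
      (addLeft a [rotInv] ++ addRight b a [s]) := by
  have f : Fits [rotInv] b b := fits_singleton.2 ⟨hb, rfl⟩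
  refine (Rel.conj (fun r hr => hr.unique (fits_addLeft a f)) (rel_addLeft_rotInvCancel hq a hb)
    (fun r hr => ?_) h).symm
  obtain rfl := hr.unique (fits_addRight b (fits_singleton.2 hs))
  exact rel_addLeft_rotCancel hq a' hb

theorem Rel.commute_rotInv_left {q : ℂ} (hq : q ≠ 0) {a b b' : ℕ} {t : Piece}
    (ht : t.Fits b b') (ha : 0 < a)
    (h : Rel q (a + b) (addRight b a [rot] ++ addLeft a [t]) (addLeft a [t] ++ addRight b' a [rot])) :
    Rel q (a + b) (addRight b a [rotInv] ++ addLeft a [t])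
      (addLeft a [t] ++ addRight b' a [rotInv]) := by
  have f : Fits [rotInv] a a := fits_singleton.2 ⟨ha, rfl⟩
  refine Rel.conj (fun r hr => hr.unique (fits_addRight b f)) (rel_addRight_rotInvCancel hq b ha)
    (fun r hr => ?_) h.symm
  obtain rfl := hr.unique (fits_addLeft a (fits_singleton.2 ht))
  exact rel_addRight_rotCancel hq b' ha

/-- Beyond the cut the strand of the lower diagram runs beneath all strands of the upper one, and on
its way slides past the event. -/
theorem rel_commute_event_rot {q : ℂ} (hq : q ≠ 0) {a a' b : ℕ} {x : Event} {i : ℕ}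
    (hs : (event x i).Fits a a') (hb : 0 < b) :
    Rel q (a + b) (addRight b a [event x i] ++ addLeft a' [rot])
      (addLeft a [rot] ++ addRight b a [event x i]) := by
  obtain ⟨h1, h2⟩ := hs
  have e1 := (rel_rotEvent (q := q) (m := a + b) (x := x) (i := i) (by omega)).append_right
    (passRight false 0 a')
  have e2 : Rel q (a + b) (rot :: event x (i + 1) :: passRight false 0 a')
      (rot :: (passRight false 0 a ++ [event x i])) :=
    .cons _ fun p hp => by
      simp only [Piece.Fits] at hp
      exact rel_event_passRight_all hq x false (by omega) (by omega) (by omega) (by omega)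
  simpa [addRight_event, addLeft_rot, addLeft_nil, addRight_nil] using e1.trans e2

theorem rel_commute_rot_event {q : ℂ} (hq : q ≠ 0) {a b b' : ℕ} {x : Event} {i : ℕ}
    (ht : (event x i).Fits b b') (ha : 0 < a) :
    Rel q (a + b) (addRight b a [rot] ++ addLeft a [event x i])
      (addLeft a [event x i] ++ addRight b' a [rot]) := by
  obtain ⟨h1, h2⟩ := ht
  obtain ⟨a, rfl⟩ : ∃ c, a = c + 1 := ⟨a - 1, by omega⟩
  have e1 : Rel q (a + 1 + b) (passRight true a b ++ [rot, event x (a + i + 1)])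
      (passRight true a b ++ [event x (a + i), rot]) :=
    .append_left _ fun p hp => (rel_rotEvent (by have := hp.of_passRight; omega)).symm
  have e2 := (rel_event_passRight_all hq x true (m := a + 1 + b) (i := a) (j := a + i) (c := b)
    (d := b') (by omega) (by omega) (by omega) (by omega)).append_right [rot]
  simp only [List.append_assoc, List.cons_append, List.nil_append] at e1 e2
  simpa [addRight_rot, addLeft_event, addLeft_nil, addRight_nil, Nat.add_right_comm]
    using e1.trans e2.symm

/-- In either order the two strands that go through the cut cross each other twice, with opposite
kinds. Once these two crossings are cancelled, both words have the same normal form `rot`,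
`passRight true (a + 1) b`, `rot`, `passRight false 1 a`. -/
theorem rel_commute_rot_rot {q : ℂ} (hq : q ≠ 0) {a b : ℕ} (ha : 0 < a) (hb : 0 < b) :
    Rel q (a + b) (addRight b a [rot] ++ addLeft a [rot])
      (addLeft a [rot] ++ addRight b a [rot]) := by
  obtain ⟨a, rfl⟩ : ∃ c, a = c + 1 := ⟨a - 1, by omega⟩
  obtain ⟨b, rfl⟩ : ∃ c, b = c + 1 := ⟨b - 1, by omega⟩
  -- On this side the two crossings lie on different sides of the cut, so one is carried through it
  -- to meet the other.
  have cut : Rel q (a + 1 + (b + 1)) [event (cross true) (a + b), rot, rot]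
      [rot, rot, event (cross true) 0] := 
    rel_cutEvent (x := cross true) (i := a + b) (by simp only [ins]; omega)
  have e1 : Rel q (a + 1 + (b + 1))
      (passRight true a b ++ ([event (cross true) (a + b), rot, rot] ++ passRight false 0 (a + 1)))
      (passRight true a b ++ ([rot, rot, event (cross true) 0] ++ passRight false 0 (a + 1))) :=
    .append_left _ fun p hp => by
      obtain rfl := hp.of_passRight
      exact cut.append_right _
  have e2 := (rel_passRight_rot (q := q) (m := a + 1 + (b + 1)) (o := true) (i := a) (c := b)
    (by omega)).append_right ([rot, event (cross true) 0] ++ passRight false 0 (a + 1))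
  have e3 : Rel q (a + 1 + (b + 1))
      ([rot] ++ (passRight true (a + 1) b ++ ([rot] ++
        ([event (cross true) 0, event (cross (!true)) 0] ++ passRight false 1 a))))
      ([rot] ++ (passRight true (a + 1) b ++ ([rot] ++ ([] ++ passRight false 1 a)))) :=
    .append_left _ fun p hp => .append_left _ fun p' hp' => .append_left _ fun p'' hp'' =>
      .append_right (rel_crossCancel hq true (i := 0) (by
        simp only [fits_rot_iff, fits_nil_iff] at hp hp''
        have := hp'.of_passRight
        omega)) _
  -- On this side the two crossings are already adjacent, between the two passages through the cut.
  have f1 : Rel q (a + 1 + (b + 1))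
      ([rot] ++ (passRight false 0 a ++ ([event (cross (!true)) (a), event (cross true) a] ++
        (passRight true (a + 1) b ++ [rot]))))
      ([rot] ++ (passRight false 0 a ++ ([] ++ (passRight true (a + 1) b ++ [rot])))) :=
    .append_left _ fun p hp => .append_left _ fun p' hp' => .append_right
      (rel_crossCancel hq false (i := a) (by
        simp only [fits_rot_iff, fits_nil_iff] at hp
        have := hp'.of_passRight
        omega)) _
  have f2 : Rel q (a + 1 + (b + 1))
      ([rot] ++ ((passRight false 0 a ++ passRight true (a + 1) b) ++ [rot]))
      ([rot] ++ ((passRight true (a + 1) b ++ passRight false 0 a) ++ [rot])) :=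
    .append_left _ fun p hp => .append_right (rel_passRight_passRight (by omega)) _
  have f3 : Rel q (a + 1 + (b + 1))
      ([rot] ++ (passRight true (a + 1) b ++ (passRight false 0 a ++ [rot])))
      ([rot] ++ (passRight true (a + 1) b ++ (rot :: passRight false 1 a))) :=
    .append_left _ fun p hp => .append_left _ fun p' hp' => rel_passRight_rot (i := 0) (c := a) (by
        simp only [fits_rot_iff, fits_nil_iff] at hp
        have := hp'.of_passRight
        omega)
  simp only [passRight_succ', List.append_assoc, List.cons_append, List.nil_append, Bool.not_true,
    Nat.zero_add] at e1 e2 e3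
  have e := e1.trans (e2.trans e3)
  simp only [List.append_assoc, List.cons_append, List.nil_append, Bool.not_true]
    at f1 f2 f3
  have f := f1.trans (f2.trans f3)
  have g : event (cross true) a :: (passRight true (a + 1) b ++ [rot]) =
      passRight true a b ++ [event (cross true) (a + b), rot] := by
    rw [← List.cons_append, ← passRight_succ', passRight_succ]
    simp
  rw [g] at f
  rw [addRight_rot, addLeft_rot, addRight_nil, addLeft_nil, Nat.add_sub_cancel,
    passRight_succ true, passRight_succ']
  nth_rw 2 [← passRight_succ']
  rw [passRight_succ]
  simp only [List.append_assoc, List.cons_append, List.nil_append, List.append_nil, Nat.zero_add]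
  exact e.trans f.symm

theorem rel_commute_piece {q : ℂ} (hq : q ≠ 0) {a a' b b' : ℕ} {s t : Piece}
    (hs : s.Fits a a') (ht : t.Fits b b') :
    Rel q (a + b) (addRight b a [s] ++ addLeft a' [t]) (addLeft a [t] ++ addRight b' a [s]) := by
  cases s with
  | event x i =>
    cases t with
    | event y j =>
      obtain ⟨h1, h2⟩ := hs
      exact rel_interchange (by omega) (by omega) rfl
    | rot =>
      obtain ⟨hb, rfl⟩ := ht
      exact rel_commute_event_rot hq hs hb
    | rotInv =>
      obtain ⟨hb, rfl⟩ := ht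
      exact .commute_rotInv_right hq hs hb (rel_commute_event_rot hq hs hb)
  | rot =>
    obtain ⟨ha, rfl⟩ := hs
    cases t with
    | event y j => exact rel_commute_rot_event hq ht ha
    | rot =>
      obtain ⟨hb, rfl⟩ := ht
      exact rel_commute_rot_rot hq ha hb
    | rotInv =>
      obtain ⟨hb, rfl⟩ := ht
      exact .commute_rotInv_right hq ⟨ha, rfl⟩ hb (rel_commute_rot_rot hq ha hb)
  | rotInv =>
    obtain ⟨ha, rfl⟩ := hs
    refine .commute_rotInv_left hq ht ha ?_
    cases t with
    | event y j => exact rel_commute_rot_event hq ht ha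
    | rot =>
      obtain ⟨hb, rfl⟩ := ht
      exact rel_commute_rot_rot hq ha hb
    | rotInv =>
      obtain ⟨hb, rfl⟩ := ht
      exact .commute_rotInv_right hq ⟨ha, rfl⟩ hb (rel_commute_rot_rot hq ha hb)

/-- The diagrams on top and below can be placed at any radii. -/
theorem rel_commute {q : ℂ} (hq : q ≠ 0) {a a' b b' : ℕ} {D E : List Piece}
    (hD : Fits D a a') (hE : Fits E b b') :
    Rel q (a + b) (addRight b a D ++ addLeft a' E) (addLeft a E ++ addRight b' a D) := by
  have key : ∀ {a a' b b' : ℕ} {s : Piece} {E : List Piece}, s.Fits a a' → Fits E b b' →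
      Rel q (a + b) (addRight b a [s] ++ addLeft a' E) (addLeft a E ++ addRight b' a [s]) := by
    intro a a' b b' s E hs hE
    induction E generalizing b with
    | nil =>
      obtain rfl := hE
      exact .of_eq (by simp [addLeft_nil])
    | cons t E ih =>
      obtain ⟨c, ht, hE⟩ := hE
      rw [addLeft_cons a', addLeft_cons a]
      have e1 := (rel_commute_piece hq hs ht).append_right (addLeft a' E)
      have e2 : Rel q (a + b) (addLeft a [t] ++ (addRight c a [s] ++ addLeft a' E))
          (addLeft a [t] ++ (addLeft a E ++ addRight b' a [s])) :=
        .append_left _ fun p hp => by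
          obtain rfl := hp.unique (fits_addLeft a (fits_singleton.2 ht))
          exact ih hE
      rw [List.append_assoc] at e1 e1 ⊢
      exact e1.trans e2
  induction D generalizing a with
  | nil =>
    obtain rfl := hD
    exact .of_eq (by simp [addRight_nil])
  | cons s D ih =>
    obtain ⟨c, hs, hD⟩ := hD
    rw [addRight_cons b hs, addRight_cons b' hs]
    have e1 : Rel q (a + b) (addRight b a [s] ++ (addRight b c D ++ addLeft a' E))
        (addRight b a [s] ++ (addLeft c E ++ addRight b' c D)) :=
      .append_left _ fun p hp => by
        obtain rfl := hp.unique (fits_addRight b (fits_singleton.2 hs))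
        exact ih hD
    have e2 := (key hs hE).append_right (addRight b' c D)
    simp only [List.append_assoc] at e1 e2 ⊢
    exact e1.trans e2

/-! ### The relative skein product -/

/-- Used to see that both sides of a move leave the same number of strands, since what follows them
is the same word. -/
theorem Fits.unique_left {w : List Piece} {m m' n : ℕ} (h : Fits w m n) (h' : Fits w m' n) :
    m = m' := by
  induction w generalizing m m' with
  | nil => exact Eq.trans h h'.symm
  | cons s w ih =>
    obtain ⟨p, hp, hw⟩ := h
    obtain ⟨p', hp', hw'⟩ := h'
    obtain rfl := ih hw hw'
    cases s <;> simp only [Piece.Fits] at hp hp' <;> omega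

theorem Diagram.star_word {k l m n : ℕ} (D : Diagram k l) (E : Diagram m n) :
    (D.star E).word = addLeft k E.word ++ addRight n k D.word := rfl

/-- The equality holds in the skein, not up to planar isotopy: a strand pulled back through the cut
leaves crossings with the added strands, which cancel only by Reidemeister II. -/
theorem Step.cls_star_left {q : ℂ} (hq : q ≠ 0) {k l m n : ℕ} {D D' : Diagram k l}
    (h : Step D D') (E : Diagram m n) : cls q (D.star E) = cls q (D'.star E) := by
  obtain ⟨A, B, u, v, p, hA, hm, h1, h2⟩ := h
  have f1 := D.fits
  have f2 := D'.fits
  rw [cls_eq_ev, cls_eq_ev, Diagram.star_word, Diagram.star_word]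
  rw [h1, List.append_assoc] at f1 ⊢
  rw [h2, List.append_assoc] at f2 ⊢
  obtain ⟨p', hp', f1⟩ := fits_append.1 f1
  obtain rfl := hA.unique hp'
  obtain ⟨r, hu, hB⟩ := fits_append.1 f1
  obtain ⟨p', hp', f2⟩ := fits_append.1 f2
  obtain rfl := hA.unique hp'
  obtain ⟨r', hv, hB'⟩ := fits_append.1 f2
  -- `addRight` depends on the running number of strands, so the tail `B` is treated alike on both
  -- sides only if it starts at the same number. `addLeft` has no such argument.
  obtain rfl := hB.unique_left hB'
  rw [addRight_append n hA, addRight_append n hu, addRight_append n hA, addRight_append n hv]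
  refine Rel.append_left _ (fun r hr => .append_left _ fun r' hr' => .append_right ?_ _) _
  obtain rfl := hr.unique (fits_addLeft k E.fits)
  obtain rfl := hr'.unique (fits_addRight n hA)
  exact hm.rel_addRight hq n hu

theorem Step.cls_star_right {q : ℂ} (hq : q ≠ 0) {k l m n : ℕ} (D : Diagram k l)
    {E E' : Diagram m n} (h : Step E E') : cls q (D.star E) = cls q (D.star E') := by
  obtain ⟨A, B, u, v, p, hA, hm, h1, h2⟩ := h
  have f1 := E.fits
  rw [cls_eq_ev, cls_eq_ev, Diagram.star_word, Diagram.star_word]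
  rw [h1, List.append_assoc] at f1 ⊢
  rw [h2, List.append_assoc]
  obtain ⟨p', hp', f1⟩ := fits_append.1 f1
  obtain rfl := hA.unique hp'
  obtain ⟨r, hu, hB⟩ := fits_append.1 f1
  simp only [addLeft_append]
  refine Rel.append_right (.append_left _ fun r hr => .append_right ?_ _) _ _
  obtain rfl := hr.unique (fits_addLeft k hA)
  exact hm.rel_addLeft hq k hu

/-- The relative skein product of two isotopy classes of diagrams. -/
noncomputable def starT {q : ℂ} (hq : q ≠ 0) {k l m n : ℕ} :
    HomT k l → HomT m n → HomS q (k + m) (l + n) :=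
  Quot.lift₂ (fun D E => cls q (D.star E)) (fun D _ _ h => Step.cls_star_right hq D h)
    (fun _ _ E h => Step.cls_star_left hq h E)

/-- The relative skein product of two formal linear combinations of diagrams. -/
noncomputable def starLin {q : ℂ} (hq : q ≠ 0) (k l m n : ℕ) :
    (HomT k l →₀ ℂ) →ₗ[ℂ] (HomT m n →₀ ℂ) →ₗ[ℂ] HomS q (k + m) (l + n) :=
  Finsupp.linearCombination ℂ fun D => Finsupp.linearCombination ℂ (starT hq D)

theorem starLin_single {q : ℂ} (hq : q ≠ 0) {k l m n : ℕ} (D : Diagram k l) (E : Diagram m n) :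
    starLin hq k l m n (Finsupp.single (.mk D) 1) (Finsupp.single (.mk E) 1) =
      cls q (D.star E) := by
  simp [starLin]
  rfl

/-- Added strands interact with a diagram only at the cut, so the small disc of the relation stays
untouched. A cap followed by a cup, or a cup followed by a cap, preserves the number of strands;
hence the tail is the same in all terms. -/
theorem SkeinRel.starLin_left {q : ℂ} (hq : q ≠ 0) {k l m n : ℕ} {x : HomT k l →₀ ℂ}
    (hx : SkeinRel q k l x) (E : Diagram m n) :
    starLin hq k l m n x (Finsupp.single (.mk E) 1) = 0 := by
  cases hx with
  | kauffmanOver A B i D D' D'' h h' h'' =>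
    have f := D.fits
    rw [h, List.append_assoc] at f
    obtain ⟨p, hA, f⟩ := fits_append.1 f
    obtain ⟨hi, f⟩ := fits_event_iff.1 f
    have e : p - 2 + 2 = p := by simp only [ins] at hi; omega
    have := ev_cross (q := q) (n := l + n) ((fits_addLeft k E.fits).append (fits_addRight n hA))
      true (i := i) (by simp only [ins] at hi; omega) (addRight n p B)
    simp only [map_sub, map_add, map_smul, LinearMap.sub_apply, LinearMap.add_apply,
      LinearMap.smul_apply, starLin_single]
    rw [sub_eq_zero, cls_eq_ev, cls_eq_ev, cls_eq_ev]
    simp only [Diagram.star_word, h, h', h'', List.append_assoc, addRight_append n hA,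
      List.cons_append, List.nil_append, addRight_event, ins, outs, Nat.add_zero, Nat.sub_zero, e]
      at this ⊢
    exact this
  | kauffmanUnder A B i D D' D'' h h' h'' =>
    have f := D.fits
    rw [h, List.append_assoc] at f
    obtain ⟨p, hA, f⟩ := fits_append.1 f
    obtain ⟨hi, f⟩ := fits_event_iff.1 f
    have e : p - 2 + 2 = p := by simp only [ins] at hi; omega
    have := ev_cross (q := q) (n := l + n) ((fits_addLeft k E.fits).append (fits_addRight n hA))
      false (i := i) (by simp only [ins] at hi; omega) (addRight n p B)
    simp only [map_sub, map_add, map_smul, LinearMap.sub_apply, LinearMap.add_apply,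
      LinearMap.smul_apply, starLin_single]
    rw [sub_eq_zero, cls_eq_ev, cls_eq_ev, cls_eq_ev]
    simp only [Diagram.star_word, h, h', h'', List.append_assoc, addRight_append n hA,
      List.cons_append, List.nil_append, addRight_event, ins, outs, Nat.add_zero, Nat.sub_zero, e]
      at this ⊢
    exact this.trans (add_comm _ _)
  | loop A B i D D' h h' =>
    have f := D.fits
    rw [h, List.append_assoc] at f
    obtain ⟨p, hA, f⟩ := fits_append.1 f
    obtain ⟨hi, f⟩ := fits_event_iff.1 f
    have := ev_loop (q := q) (n := l + n) ((fits_addLeft k E.fits).append (fits_addRight n hA))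
      (i := i) (by simp only [ins] at hi; omega) (addRight n p B)
    simp only [map_sub, map_smul, LinearMap.sub_apply, LinearMap.smul_apply, starLin_single]
    rw [sub_eq_zero, cls_eq_ev, cls_eq_ev]
    simp only [Diagram.star_word, h, h', List.append_assoc, addRight_append n hA,
      List.cons_append, List.nil_append, addRight_event, ins, outs, Nat.add_zero, Nat.sub_zero,
      Nat.add_sub_cancel] at this ⊢
    exact this

theorem SkeinRel.starLin_right {q : ℂ} (hq : q ≠ 0) {k l m n : ℕ} (D : Diagram k l)
    {x : HomT m n →₀ ℂ} (hx : SkeinRel q m n x) :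
    starLin hq k l m n (Finsupp.single (.mk D) 1) x = 0 := by
  cases hx with
  | kauffmanOver A B i E E' E'' h h' h'' =>
    have f := E.fits
    rw [h, List.append_assoc] at f
    obtain ⟨p, hA, f⟩ := fits_append.1 f
    obtain ⟨hi, f⟩ := fits_event_iff.1 f
    have := ev_cross (q := q) (n := l + n) (fits_addLeft k hA)
      true (i := k + i) (by simp only [ins] at hi; omega) (addLeft k B ++ addRight n k D.word)
    simp only [map_sub, map_add, map_smul, starLin_single]
    rw [sub_eq_zero, cls_eq_ev, cls_eq_ev, cls_eq_ev]
    simp only [Diagram.star_word, h, h', h'', List.append_assoc, addLeft_append,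
      List.cons_append, List.nil_append, addLeft_event] at this ⊢
    exact this
  | kauffmanUnder A B i E E' E'' h h' h'' =>
    have f := E.fits
    rw [h, List.append_assoc] at f
    obtain ⟨p, hA, f⟩ := fits_append.1 f
    obtain ⟨hi, f⟩ := fits_event_iff.1 f
    have := ev_cross (q := q) (n := l + n) (fits_addLeft k hA)
      false (i := k + i) (by simp only [ins] at hi; omega) (addLeft k B ++ addRight n k D.word)
    simp only [map_sub, map_add, map_smul, starLin_single]
    rw [sub_eq_zero, cls_eq_ev, cls_eq_ev, cls_eq_ev]
    simp only [Diagram.star_word, h, h', h'', List.append_assoc, addLeft_append,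
      List.cons_append, List.nil_append, addLeft_event] at this ⊢
    exact this.trans (add_comm _ _)
  | loop A B i E E' h h' =>
    have f := E.fits
    rw [h, List.append_assoc] at f
    obtain ⟨p, hA, f⟩ := fits_append.1 f
    obtain ⟨hi, f⟩ := fits_event_iff.1 f
    have := ev_loop (q := q) (n := l + n) (fits_addLeft k hA)
      (i := k + i) (by simp only [ins] at hi; omega) (addLeft k B ++ addRight n k D.word)
    simp only [map_sub, map_smul, starLin_single]
    rw [sub_eq_zero, cls_eq_ev, cls_eq_ev]
    simp only [Diagram.star_word, h, h', List.append_assoc, addLeft_append,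
      List.cons_append, List.nil_append, addLeft_event] at this ⊢
    exact this

theorem starLin_eq_zero_left {q : ℂ} (hq : q ≠ 0) {k l m n : ℕ} {x : HomT k l →₀ ℂ}
    (hx : x ∈ skeinSubmodule q k l) : starLin hq k l m n x = 0 := by
  induction hx using Submodule.span_induction with
  | mem x hx =>
    refine Finsupp.lhom_ext' fun E => LinearMap.ext_ring ?_
    obtain ⟨F, rfl⟩ : ∃ F, E = HomT.mk F := (Quot.exists_rep E).imp fun _ h => h.symm
    exact hx.starLin_left hq F
  | zero => simp
  | add x y _ _ hx hy => rw [map_add, hx, hy, add_zero]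
  | smul a x _ hx => rw [map_smul, hx, smul_zero]

theorem starLin_eq_zero_right {q : ℂ} (hq : q ≠ 0) {k l m n : ℕ} (x : HomT k l →₀ ℂ)
    {y : HomT m n →₀ ℂ} (hy : y ∈ skeinSubmodule q m n) : starLin hq k l m n x y = 0 := by
  induction hy using Submodule.span_induction with
  | mem y hy =>
    suffices (starLin hq k l m n).flip y = 0 from congrArg (fun f => f x) this
    refine Finsupp.lhom_ext' fun D => LinearMap.ext_ring ?_
    obtain ⟨F, rfl⟩ : ∃ F, D = HomT.mk F := (Quot.exists_rep D).imp fun _ h => h.symm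
    exact hy.starLin_right hq F
  | zero => simp
  | add x y _ _ hx hy => rw [map_add, hx, hy, add_zero]
  | smul a x _ hx => rw [map_smul, hx, smul_zero]

/-- The relative skein product. -/
noncomputable def skeinProd {q : ℂ} (hq : q ≠ 0) (k l m n : ℕ) :
    HomS q k l →ₗ[ℂ] HomS q m n →ₗ[ℂ] HomS q (k + m) (l + n) :=
  (skeinSubmodule q k l).liftQ
    (LinearMap.mk₂ ℂ
      (fun x => (skeinSubmodule q m n).liftQ (starLin hq k l m n x)
        (fun _ hy => starLin_eq_zero_right hq x hy))
      (fun x x' y => by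
        obtain ⟨y, rfl⟩ := Submodule.Quotient.mk_surjective _ y
        exact congrArg (fun f => f y) (map_add (starLin hq k l m n) x x'))
      (fun c x y => by
        obtain ⟨y, rfl⟩ := Submodule.Quotient.mk_surjective _ y
        exact congrArg (fun f => f y) (map_smul (starLin hq k l m n) c x))
      (fun x y y' => map_add _ y y')
      (fun c x y => map_smul _ c y))
    (fun x hx => by
      rw [LinearMap.mem_ker]
      refine LinearMap.ext fun y => ?_
      obtain ⟨y, rfl⟩ := Submodule.Quotient.mk_surjective _ y
      exact congrArg (fun f => f y) (starLin_eq_zero_left hq hx))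

theorem skeinProd_cls {q : ℂ} (hq : q ≠ 0) {k l m n : ℕ} (D : Diagram k l) (E : Diagram m n) :
    skeinProd hq k l m n (cls q D) (cls q E) = cls q (D.star E) := starLin_single hq D E

/-- For diagrams the two words differ only in the order of the two middle factors, the inner upper
diagram and the outer lower one, which `rel_commute` exchanges. -/
theorem skeinProd_comp {q : ℂ} (hq : q ≠ 0) {k l r m n s : ℕ} (Y' : HomS q l r) (Y : HomS q k l)
    (Z' : HomS q n s) (Z : HomS q m n) :
    skeinProd hq k r m s (comp q k l r Y' Y) (comp q m n s Z' Z) =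
      comp q (k + m) (l + n) (r + s) (skeinProd hq l r n s Y' Z') (skeinProd hq k l m n Y Z) := by
  induction Y' using HomS.induction with
  | hz => simp
  | ha x y hx hy => simp [hx, hy]
  | hs c x hx => simp [hx]
  | hc D' =>
  induction Y using HomS.induction with
  | hz => simp
  | ha x y hx hy => simp [hx, hy]
  | hs c x hx => simp [hx]
  | hc D =>
  induction Z' using HomS.induction with
  | hz => simp
  | ha x y hx hy => simp [hx, hy]
  | hs c x hx => simp [hx]
  | hc E' =>
  induction Z using HomS.induction with
  | hz => simp
  | ha x y hx hy => simp [hx, hy]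
  | hs c x hx => simp [hx]
  | hc E =>
  simp only [comp_cls, skeinProd_cls]
  rw [cls_eq_ev, cls_eq_ev]
  simp only [Diagram.star_word, Diagram.comp, addLeft_append, addRight_append s D.fits,
    List.append_assoc]
  refine Rel.append_left _ (fun p hp => ?_) _
  obtain rfl := hp.unique (fits_addLeft k E.fits)
  have := ((rel_commute hq D.fits E'.fits).symm.append_right (addRight s l D'.word))
  simpa only [List.append_assoc] using this

/-! ### Associativity and units of the relative skein product -/

/-- Transport of skein elements along equalities of the numbers of endpoints. -/
def HomS.cast {q : ℂ} {m n m' n' : ℕ} (hm : m = m') (hn : n = n') (Y : HomS q m n) :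
    HomS q m' n' := hm ▸ hn ▸ Y

theorem HomS.cast_zero {q : ℂ} {m n m' n' : ℕ} (hm : m = m') (hn : n = n') :
    (0 : HomS q m n).cast hm hn = 0 := by subst hm hn; rfl

theorem HomS.cast_add {q : ℂ} {m n m' n' : ℕ} (hm : m = m') (hn : n = n') (x y : HomS q m n) :
    (x + y).cast hm hn = x.cast hm hn + y.cast hm hn := by subst hm hn; rfl

theorem HomS.cast_smul {q : ℂ} {m n m' n' : ℕ} (hm : m = m') (hn : n = n') (c : ℂ)
    (x : HomS q m n) : (c • x).cast hm hn = c • x.cast hm hn := by subst hm hn; rfl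

theorem HomS.cast_ev {q : ℂ} {m n m' n' : ℕ} (hm : m = m') (hn : n = n') (w : List Piece) :
    (ev q m n w).cast hm hn = ev q m' n' w := by subst hm hn; rfl

theorem HomS.cast_comp {q : ℂ} {k m n k' m' n' : ℕ} (hk : k = k') (hm : m = m') (hn : n = n')
    (Z : HomS q m n) (Y : HomS q k m) :
    (comp q k m n Z Y).cast hk hn = comp q k' m' n' (Z.cast hm hn) (Y.cast hk hm) := by
  subst hk hm hn; rfl

theorem skeinProd_assoc {q : ℂ} (hq : q ≠ 0) {a l b m c n : ℕ} (Y : HomS q a l) (Z : HomS q b m)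
    (W : HomS q c n) :
    (skeinProd hq _ _ _ _ (skeinProd hq _ _ _ _ Y Z) W).cast (Nat.add_assoc a b c)
      (Nat.add_assoc l m n) = skeinProd hq _ _ _ _ Y (skeinProd hq _ _ _ _ Z W) := by
  induction Y using HomS.induction with
  | hz => simp [HomS.cast_zero]
  | ha x y hx hy => simp [HomS.cast_add, hx, hy]
  | hs c x hx => simp [HomS.cast_smul, hx]
  | hc D =>
  induction Z using HomS.induction with
  | hz => simp [HomS.cast_zero]
  | ha x y hx hy => simp [HomS.cast_add, hx, hy]
  | hs c x hx => simp [HomS.cast_smul, hx]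
  | hc E =>
  induction W using HomS.induction with
  | hz => simp [HomS.cast_zero]
  | ha x y hx hy => simp [HomS.cast_add, hx, hy]
  | hs c x hx => simp [HomS.cast_smul, hx]
  | hc F =>
  simp only [skeinProd_cls]
  rw [cls_eq_ev, cls_eq_ev, HomS.cast_ev]
  simp only [Diagram.star_word, addLeft_append, addLeft_addLeft, List.append_assoc]
  rw [addRight_append n (fits_addLeft a E.fits), addRight_addRight n m D.fits,
    addLeft_addRight a n E.fits]

theorem skeinProd_one_left {q : ℂ} (hq : q ≠ 0) {m n : ℕ} (Y : HomS q m n) :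
    (skeinProd hq 0 0 m n (cls q (.one 0)) Y).cast (Nat.zero_add m) (Nat.zero_add n) = Y := by
  induction Y using HomS.induction with
  | hz => simp [HomS.cast_zero]
  | ha x y hx hy => simp [HomS.cast_add, hx, hy]
  | hs c x hx => simp [HomS.cast_smul, hx]
  | hc D =>
  rw [skeinProd_cls, cls_eq_ev, cls_eq_ev, HomS.cast_ev]
  simp [Diagram.star_word, Diagram.one, addLeft_zero, addRight_nil]

theorem skeinProd_one_right {q : ℂ} (hq : q ≠ 0) {m n : ℕ} (Y : HomS q m n) :
    skeinProd hq m n 0 0 Y (cls q (.one 0)) = Y := by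
  induction Y using HomS.induction with
  | hz => simp
  | ha x y hx hy => simp only [map_add, LinearMap.add_apply, hx, hy]
  | hs c x hx => simp only [map_smul, LinearMap.smul_apply, hx]
  | hc D =>
  rw [skeinProd_cls, cls_eq_ev, cls_eq_ev]
  simp [Diagram.star_word, Diagram.one, addRight_zero, addLeft_nil]

section

/-! ### Turning strands and loops -/

theorem turn_zero (q : ℂ) : turn q 0 = ev q 0 0 [event cup 0, rot, event cap 0] := cls_eq_ev q _

theorem turn_one (q : ℂ) : turn q 1 = ev q 1 1 [rot] := cls_eq_ev q _

theorem cls_cPlus (q : ℂ) : cls q cPlus = ev q 0 2 [event cup 0] := cls_eq_ev q _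

theorem cls_cMinus (q : ℂ) : cls q cMinus = ev q 0 2 [event cup 0, rot] := cls_eq_ev q _

theorem comp_ev {q : ℂ} {k m n : ℕ} {A : List Piece} (hA : Fits A k m) (w : List Piece) :
    comp q k m n (ev q m n w) (ev q k m A) = ev q k n (A ++ w) := (ev_append hA w).symm

/-- The words in this group arise when the crossing of an essential loop with a radial strand is
smoothed: loop and strand merge into one strand that winds once, in one direction or the other. -/
theorem rel_cup_rot_cap (q : ℂ) : Rel q 1 [event cup 0, rot, event cap 0] [rot] := by
  have e1 := (rel_rotEvent (q := q) (m := 1) (x := cup) (i := 0) (by simp [ins])).append_right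
    [event cap 0]
  have e2 : Rel q 1 [rot, event cup 1, event cap 0] [rot] :=
    .cons _ fun p hp => rel_zigzag (by simp only [Piece.Fits] at hp; omega)
  exact e1.trans e2

theorem rel_cup_rot (q : ℂ) : Rel q 1 [event cup 1, rot] [event cup 0, rotInv] := by
  have e1 : Rel q 1 [event cup 1, rot, rot, rotInv] [event cup 1, rot] :=
    .append_left [event cup 1, rot] fun p hp => rel_rotCancel (by
      simp only [fits_event_iff, fits_rot_iff, fits_nil_iff, ins, outs] at hp
      omega)
  have e2 := (rel_cutEvent (q := q) (m := 1) (x := cup) (i := 1) (by simp [ins])).append_right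
    [rotInv]
  exact e1.symm.trans e2

theorem rel_rotInv_cap (q : ℂ) : Rel q 3 [rotInv, event cap 0] [event cap 1, rotInv] := by
  have e1 : Rel q 3 [rotInv, event cap 0, rot, rotInv] [rotInv, event cap 0] :=
    .append_left [rotInv, event cap 0] fun p hp => rel_rotCancel (by
      simp only [fits_event_iff, fits_rotInv_iff, fits_nil_iff, ins, outs] at hp
      omega)
  have e2 : Rel q 3 [rotInv, event cap 0, rot, rotInv] [rotInv, rot, event cap 1, rotInv] :=
    .cons _ fun p hp => (rel_rotEvent (x := cap) (i := 0) (by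
      simp only [Piece.Fits] at hp; simp only [ins]; omega)).append_right [rotInv]
  have e3 := (rel_rotInvCancel (q := q) (m := 3) (by omega)).append_right [event cap 1, rotInv]
  exact e1.symm.trans (e2.trans e3)

theorem rel_cup_rot_cap_inv (q : ℂ) : Rel q 1 [event cup 1, rot, event cap 0] [rotInv] := by
  have e1 := (rel_cup_rot q).append_right [event cap 0]
  have e2 : Rel q 1 [event cup 0, rotInv, event cap 0] [event cup 0, event cap 1, rotInv] :=
    .cons _ fun p hp => by
      obtain rfl : p = 3 := by simp only [Piece.Fits, ins, outs] at hp; omega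
      exact rel_rotInv_cap q
  have e3 := (rel_zagzig (q := q) (m := 1) (i := 0) (by omega)).append_right [rotInv]
  exact e1.trans (e2.trans e3)

theorem rel_cup_rot_cap_last (q : ℂ) : Rel q 1 [event cup 1, rot, event cap 1] [rot] := by
  have e1 := (rel_cup_rot q).append_right [event cap 1]
  have e2 : Rel q 1 [event cup 0, rotInv, event cap 1]
      [event cup 0, rotInv, rot, rot, event cap 0] :=
    .append_left [event cup 0, rotInv] fun p hp => by
      obtain rfl : p = 3 := by
        simp only [fits_event_iff, fits_rotInv_iff, fits_nil_iff, ins, outs] at hp; omega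
      exact rel_cutEvent (x := cap) (by simp [ins])
  have e3 : Rel q 1 [event cup 0, rotInv, rot, rot, event cap 0]
      [event cup 0, rot, event cap 0] :=
    .cons _ fun p hp => (rel_rotInvCancel (by
      simp only [Piece.Fits, ins, outs] at hp; omega)).append_right [rot, event cap 0]
  exact e1.trans (e2.trans (e3.trans (rel_cup_rot_cap q)))

variable {q : ℂ}

/-- An essential loop on top of a radial strand. -/
theorem skeinProd_turn_zero_one (hq : q ≠ 0) :
    skeinProd hq 0 0 1 1 (turn q 0) (cls q (.one 1)) = q • ev q 1 1 [rot] + q⁻¹ • ev q 1 1 [rotInv] := by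
  refine (skeinProd_cls hq _ _).trans ((cls_eq_ev q _).trans ?_)
  change ev q 1 1 [event cup 0, event (cross true) 1, rot, event cap 0] = _
  have e := ev_cross (q := q) (m := 1) (n := 1) (p := 3) (A := [event cup 0])
    (by simp [fits_event_iff, fits_nil_iff, ins, outs]) true (i := 1) (by omega)
    [rot, event cap 0]
  refine e.trans (congrArg₂ _ (congrArg _ (rel_cup_rot_cap q 1)) (congrArg _ ?_))
  exact (((rel_zagzig (q := q) (m := 1) (i := 0) (by omega)).append_right
    [event cup 1, rot, event cap 0]).trans (rel_cup_rot_cap_inv q)) 1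

/-- An essential loop below a radial strand. -/
theorem skeinProd_one_turn_zero (hq : q ≠ 0) :
    skeinProd hq 1 1 0 0 (cls q (.one 1)) (turn q 0) = q⁻¹ • ev q 1 1 [rot] + q • ev q 1 1 [rotInv] := by
  refine (skeinProd_cls hq _ _).trans ((cls_eq_ev q _).trans ?_)
  change ev q 1 1 [event cup 1, rot, event (cross false) 0, event cap 1] = _
  have e := ev_cross (q := q) (m := 1) (n := 1) (p := 3) (A := [event cup 1, rot])
    (by simp [fits_event_iff, fits_rot_iff, fits_nil_iff, ins, outs]) false (i := 0) (by omega)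
    [event cap 1]
  refine e.trans (congrArg₂ _ (congrArg _ (rel_cup_rot_cap_last q 1)) (congrArg _ ?_))
  refine (((rel_cup_rot_cap_inv q).append_right [event cup 0, event cap 1]).trans ?_) 1
  refine .append_left [rotInv] fun p hp => rel_zagzig ?_
  simp only [fits_rotInv_iff, fits_nil_iff] at hp
  omega

theorem skeinProd_turn_one_one (hq : q ≠ 0) :
    skeinProd hq 1 1 1 1 (turn q 1) (cls q (.one 1)) = ev q 2 2 [event (cross true) 0, rot] :=
  (skeinProd_cls hq _ _).trans (cls_eq_ev q _)

theorem skeinProd_one_turn_one (hq : q ≠ 0) :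
    skeinProd hq 1 1 1 1 (cls q (.one 1)) (turn q 1) = ev q 2 2 [rot, event (cross false) 0] :=
  (skeinProd_cls hq _ _).trans (cls_eq_ev q _)

theorem fits_cup : Fits [event cup 0] 0 2 := by
  simp [fits_event_iff, fits_nil_iff, ins, outs]

theorem fits_cup_rot : Fits [event cup 0, rot] 0 2 := by
  simp [fits_event_iff, fits_rot_iff, fits_nil_iff, ins, outs]

theorem rel_cup_rot_rot (q : ℂ) : Rel q 0 [event cup 0, rot, rot] [event cup 0] :=
  rel_cutEvent (x := cup) (by simp [ins])

/-- The value of a curl: for `q ≠ 0` the factor is `-q⁻³` for `o = true` and `-q³` for `o = false`.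
-/
theorem ev_cup_cross (o : Bool) (B : List Piece) (n : ℕ) :
    ev q 0 n (event cup 0 :: event (cross o) 0 :: B) =
      (kauffmanCoeff q o - kauffmanCoeff q (!o) * (q ^ 2 + (q ^ 2)⁻¹)) •
        ev q 0 n (event cup 0 :: B) := by
  have e1 := ev_cross (q := q) (n := n) fits_cup o (i := 0) (by omega) B
  have e2 := ev_loop (q := q) (m := 0) (n := n) (p := 0) (A := []) rfl (i := 0) le_rfl
    (event cup 0 :: B)
  simp only [List.cons_append, List.nil_append] at e1 e2
  rw [e1, e2]
  module

/-- Turning the upper strand replaces `q c₊ + c₋` by `q c₊ + q⁻¹ c₋ ∘ X - q⁻² c₋`, the last term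
being a curl. This is `U` again precisely when `X` acts on `c₋` by `q + q⁻¹`, which explains both
the coefficients of `U` and the weight of `X`. -/
theorem skeinProd_turn_one_comp_U (hq : q ≠ 0) :
    comp q 0 2 2 (skeinProd hq 1 1 1 1 (turn q 1) (cls q (.one 1))) (U q 1) =
      U q 1 + q⁻¹ • (comp q 0 0 2 (cls q cMinus) (turn q 0) - (q + q⁻¹) • cls q cMinus) := by
  have hX : Fits [event cup 0, rot, event cap 0] 0 0 := by
    simp [fits_event_iff, fits_rot_iff, fits_nil_iff, ins, outs]
  have e := ev_cross (q := q) (n := 2) fits_cup_rot true (i := 0) (by omega) [rot]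
  simp only [List.cons_append, List.nil_append] at e
  rw [rel_cup_rot_rot q 2] at e
  rw [skeinProd_turn_one_one, U, cls_cPlus, cls_cMinus, turn_zero, map_add, map_smul, map_smul,
    comp_ev fits_cup, comp_ev fits_cup_rot, comp_ev hX]
  simp only [List.cons_append, List.nil_append]
  rw [ev_cup_cross, e]
  simp only [kauffmanCoeff, Bool.not_true, if_true, Bool.false_eq_true, if_false]
  match_scalars <;> field_simp
  ring

theorem skeinProd_one_turn_comp_U (hq : q ≠ 0) :
    comp q 0 2 2 (skeinProd hq 1 1 1 1 (cls q (.one 1)) (turn q 1)) (U q 1) =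
      U q 1 + q ^ 2 • (comp q 0 0 2 (cls q cPlus) (turn q 0) - (q + q⁻¹) • cls q cPlus) := by
  have hX : Fits [event cup 0, rot, event cap 0] 0 0 := by
    simp [fits_event_iff, fits_rot_iff, fits_nil_iff, ins, outs]
  have e := ev_cross (q := q) (n := 2) fits_cup_rot false (i := 0) (by omega) []
  have e' := (rel_cup_rot_rot q).append_right [event (cross false) 0] 2
  simp only [List.cons_append, List.nil_append] at e e'
  rw [skeinProd_one_turn_one, U, cls_cPlus, cls_cMinus, turn_zero, map_add, map_smul, map_smul,
    comp_ev fits_cup, comp_ev fits_cup_rot, comp_ev hX]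
  simp only [List.cons_append, List.nil_append]
  rw [e, e', ev_cup_cross]
  simp only [kauffmanCoeff, Bool.not_false, if_true, Bool.false_eq_true, if_false]
  match_scalars <;> field_simp
  ring

theorem skeinProd_cls_ev (hq : q ≠ 0) {k l m n : ℕ} (D : Diagram k l) (E : Diagram m n) :
    skeinProd hq k l m n (cls q D) (cls q E) = ev q (k + m) (l + n) (D.star E).word :=
  (skeinProd_cls hq _ _).trans (cls_eq_ev q _)

/-- Written with `ρ` on the inside, to be compared with `skeinProd_one_U`: the third terms coincide,
and for `ρ = 1` the first two are exchanged. -/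
theorem skeinProd_U_one (hq : q ≠ 0) :
    skeinProd hq 0 2 1 1 (U q 1) (cls q (.one 1)) =
      q • ev q 1 3 [event cup 0] + q • comp q 1 1 3 (ev q 1 3 [event cup 1]) (turn q 1) +
        q⁻¹ • ev q 1 3 [event cup 1, rot] := by
  have e := ev_cross (q := q) (m := 1) (n := 3) (p := 3) (A := [event cup 0])
    (by simp [fits_event_iff, fits_nil_iff, ins, outs]) true (i := 1) (by omega) [rot]
  have e1 := rel_rotEvent (q := q) (m := 1) (x := cup) (i := 0) (by simp [ins]) 3
  have e2 := (rel_zagzig (q := q) (m := 1) (i := 0) (by omega)).append_right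
    [event cup 1, rot] 3
  simp only [List.cons_append, List.nil_append] at e e2
  rw [e1, e2] at e
  rw [U, map_add, map_smul, map_smul, LinearMap.add_apply, LinearMap.smul_apply,
    LinearMap.smul_apply, skeinProd_cls_ev, skeinProd_cls_ev, turn_one,
    comp_ev (by simp [fits_rot_iff, fits_nil_iff]), one_smul, add_assoc]
  exact congrArg _ e

theorem skeinProd_one_U (hq : q ≠ 0) :
    skeinProd hq 1 1 0 2 (cls q (.one 1)) (U q 1) =
      q • ev q 1 3 [event cup 1] +
        q • comp q 1 1 3 (ev q 1 3 [event cup 0]) (ev q 1 1 [rotInv]) +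
          q⁻¹ • ev q 1 3 [event cup 1, rot] := by
  have e := ev_cross (q := q) (m := 1) (n := 3) (p := 3) (A := [event cup 1, rot])
    (by simp [fits_event_iff, fits_rot_iff, fits_nil_iff, ins, outs]) false (i := 0) (by omega) []
  have e1 := (rel_cup_rot_cap_inv q).append_right [event cup 0] 3
  simp only [List.cons_append, List.nil_append] at e e1
  rw [e1] at e
  rw [U, map_add, map_smul, map_smul, skeinProd_cls_ev, skeinProd_cls_ev,
    comp_ev (by simp [fits_rotInv_iff, fits_nil_iff]), one_smul, add_assoc]
  exact congrArg _ (e.trans (add_comm _ _))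

end

section

/-! ### The algebra of link patterns -/

variable {q : ℂ}

theorem toV_surjective {a n : ℕ} (h : a = n % 2) : Function.Surjective (toV q h) := by
  subst h
  exact Submodule.mkQ_surjective _

theorem toV_comp_turn {a n : ℕ} (h : a = n % 2) (Y : HomS q a n) :
    toV q h (comp q a a n Y (turn q a)) = weight q n • toV q h Y := by
  subst h
  rw [← map_smul]
  exact (Submodule.Quotient.eq _).2 (Submodule.subset_span ⟨Y, rfl⟩)

theorem weight_of_even {n : ℕ} (h : 0 = n % 2) : weight q n = q + q⁻¹ := if_pos h.symm

theorem weight_of_odd {n : ℕ} (h : 1 = n % 2) : weight q n = 1 := if_neg (by omega)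

theorem toV_comp_turn_zero {n : ℕ} (h : 0 = n % 2) (Y : HomS q 0 n) :
    toV q h (comp q 0 0 n Y (turn q 0)) = (q + q⁻¹) • toV q h Y :=
  (toV_comp_turn h Y).trans (congrArg (· • toV q h Y) (weight_of_even h))

theorem toV_comp_turn_one {n : ℕ} (h : 1 = n % 2) (Y : HomS q 1 n) :
    toV q h (comp q 1 1 n Y (turn q 1)) = toV q h Y :=
  ((toV_comp_turn h Y).trans (congrArg (· • toV q h Y) (weight_of_odd h))).trans (one_smul _ _)

theorem toV_comp_rot {n : ℕ} (h : 1 = n % 2) (Y : HomS q 1 n) :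
    toV q h (comp q 1 1 n Y (ev q 1 1 [rot])) = toV q h Y := by
  rw [← turn_one, toV_comp_turn_one]

/-- `ρ` acts by `1`, so its inverse does too: apply the relation to `Y ∘ ρ⁻¹`. -/
theorem toV_comp_rotInv {n : ℕ} (h : 1 = n % 2) (Y : HomS q 1 n) :
    toV q h (comp q 1 1 n Y (ev q 1 1 [rotInv])) = toV q h Y := by
  rw [← toV_comp_rot h, ← comp_assoc, comp_ev (by simp [fits_rot_iff, fits_nil_iff])]
  have e : ev q 1 1 [rot, rotInv] = cls q (.one 1) :=
    (rel_rotCancel (m := 1) one_pos 1).trans (cls_eq_ev q (.one 1)).symm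
  rw [List.singleton_append, e, comp_one]

/-- The axioms of a graded monoid compare pairs of a degree and an element, so a transport along an
equality of degrees is absorbed by the pair. -/
theorem mk_toV_cast {a n a' n' : ℕ} (h : a = n % 2) (h' : a' = n' % 2) (ha : a = a') (hn : n = n')
    (Y : HomS q a n) :
    GradedMonoid.mk (A := LinkSpace q) n (toV q h Y) = .mk n' (toV q h' (Y.cast ha hn)) := by
  subst ha hn
  rfl

theorem add_eq_mod_two {a b m n : ℕ} (ha : a = m % 2) (hb : b = n % 2)
    (h : ¬(a = 1 ∧ b = 1)) : a + b = (m + n) % 2 := by omega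

theorem zero_eq_add_mod_two {a b m n : ℕ} (ha : a = m % 2) (hb : b = n % 2)
    (h : a = 1 ∧ b = 1) : 0 = (m + n) % 2 := by omega

theorem zero_eq_add_mod_two_of_odd {m n : ℕ} (hm : 1 = m % 2) (hn : 1 = n % 2) :
    0 = (m + n) % 2 := by omega

/-- The multiplication of the algebra of link patterns on representatives. -/
noncomputable def mulHom (hq : q ≠ 0) {a b m n : ℕ} (ha : a = m % 2) (hb : b = n % 2) :
    HomS q a m →ₗ[ℂ] HomS q b n →ₗ[ℂ] LinkSpace q (m + n) :=
  if h : a = 1 ∧ b = 1 then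
    (skeinProd hq a m b n).compr₂ (toV q (zero_eq_add_mod_two ha hb h) ∘ₗ
      (comp q 0 (a + b) (m + n)).flip ((U q 1).cast rfl (show 2 = a + b by omega)))
  else (skeinProd hq a m b n).compr₂ (toV q (add_eq_mod_two ha hb h))

theorem mulHom_of_not (hq : q ≠ 0) {a b m n : ℕ} (ha : a = m % 2) (hb : b = n % 2)
    (h : ¬(a = 1 ∧ b = 1)) (Y : HomS q a m) (Z : HomS q b n) :
    mulHom hq ha hb Y Z =
      toV q (add_eq_mod_two ha hb h) (skeinProd hq a m b n Y Z) := by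
  rw [mulHom, dif_neg h]
  rfl

theorem mulHom_of_and (hq : q ≠ 0) {a b m n : ℕ} (ha : a = m % 2) (hb : b = n % 2)
    (h : a = 1 ∧ b = 1) (Y : HomS q a m) (Z : HomS q b n) :
    mulHom hq ha hb Y Z = toV q (zero_eq_add_mod_two ha hb h) (comp q 0 (a + b) (m + n)
      (skeinProd hq a m b n Y Z) ((U q 1).cast rfl (show 2 = a + b by omega))) := by
  rw [mulHom, dif_pos h]
  rfl

theorem mulHom_one_one (hq : q ≠ 0) {m n : ℕ} (hm : 1 = m % 2) (hn : 1 = n % 2)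
    (Y : HomS q 1 m) (Z : HomS q 1 n) :
    mulHom hq hm hn Y Z = toV q (zero_eq_add_mod_two_of_odd hm hn)
      (comp q 0 2 (m + n) (skeinProd hq 1 m 1 n Y Z) (U q 1)) :=
  mulHom_of_and hq hm hn ⟨rfl, rfl⟩ Y Z

theorem skeinProd_comp_left (hq : q ≠ 0) {k a m b n : ℕ} (Y : HomS q a m) (w : HomS q k a)
    (Z : HomS q b n) :
    skeinProd hq k m b n (comp q k a m Y w) Z = comp q (k + b) (a + b) (m + n)
      (skeinProd hq a m b n Y Z) (skeinProd hq k a b b w (cls q (.one b))) := by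
  rw [← skeinProd_comp, comp_one]

theorem skeinProd_comp_right (hq : q ≠ 0) {k a m b n : ℕ} (Y : HomS q a m) (Z : HomS q b n)
    (w : HomS q k b) :
    skeinProd hq a m k n Y (comp q k b n Z w) = comp q (a + k) (a + b) (m + n)
      (skeinProd hq a m b n Y Z) (skeinProd hq a a k b (cls q (.one a)) w) := by
  rw [← skeinProd_comp, comp_one]

/-- The multiplication is balanced in its first argument, as required by `liftV`. The interchange
law moves `X` or `ρ` to the innermost position, where only its product with radial strands matters.
-/
theorem mulHom_comp_turn_left (hq : q ≠ 0) {a b m n : ℕ} (ha : a = m % 2) (hb : b = n % 2)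
    (Y : HomS q a m) (Z : HomS q b n) :
    mulHom hq ha hb (comp q a a m Y (turn q a)) Z = weight q m • mulHom hq ha hb Y Z := by
  obtain rfl | rfl : a = 0 ∨ a = 1 := by omega
  · refine Eq.trans ?_ (congrArg (· • mulHom hq ha hb Y Z) (weight_of_even ha).symm)
    rw [mulHom_of_not hq ha hb (by omega), mulHom_of_not hq ha hb (by omega), skeinProd_comp_left]
    obtain rfl | rfl : b = 0 ∨ b = 1 := by omega
    · rw [skeinProd_one_right]
      exact toV_comp_turn_zero _ _
    -- For odd `b` the loop becomes `q ρ + q⁻¹ ρ⁻¹`, and `ρ = 1` turns this into the weight of even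
    -- degrees.
    · rw [skeinProd_turn_zero_one, map_add, map_smul, map_smul, map_add, map_smul, map_smul]
      refine (congrArg₂ (fun x y => q • x + q⁻¹ • y) (toV_comp_rot _ _)
        (toV_comp_rotInv _ _)).trans ?_
      exact (add_smul _ _ _).symm
  · refine Eq.trans ?_ ((one_smul ℂ _).symm.trans
      (congrArg (· • mulHom hq ha hb Y Z) (weight_of_odd ha).symm))
    obtain rfl | rfl : b = 0 ∨ b = 1 := by omega
    · rw [mulHom_of_not hq ha hb (by omega), mulHom_of_not hq ha hb (by omega),
        skeinProd_comp_left, skeinProd_one_right]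
      exact toV_comp_turn_one _ _
    · rw [mulHom_one_one, mulHom_one_one, skeinProd_comp_left]
      refine (congrArg _ (comp_assoc q _ _ _).symm).trans ?_
      refine (congrArg (fun x => toV q _ (comp q 0 2 (m + n) _ x))
        (skeinProd_turn_one_comp_U hq)).trans ?_
      rw [map_add, map_smul, map_sub, map_smul, comp_assoc, map_add, map_smul, map_sub, map_smul,
        toV_comp_turn_zero, sub_self, smul_zero, add_zero]

theorem mulHom_comp_turn_right (hq : q ≠ 0) {a b m n : ℕ} (ha : a = m % 2) (hb : b = n % 2)
    (Y : HomS q a m) (Z : HomS q b n) :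
    mulHom hq ha hb Y (comp q b b n Z (turn q b)) = weight q n • mulHom hq ha hb Y Z := by
  obtain rfl | rfl : b = 0 ∨ b = 1 := by omega
  · refine Eq.trans ?_ (congrArg (· • mulHom hq ha hb Y Z) (weight_of_even hb).symm)
    rw [mulHom_of_not hq ha hb (by omega), mulHom_of_not hq ha hb (by omega), skeinProd_comp_right]
    obtain rfl | rfl : a = 0 ∨ a = 1 := by omega
    · refine (congrArg (fun x => toV q _ (comp q 0 0 (m + n) _ x))
        (skeinProd_one_left hq (turn q 0))).trans ?_
      exact toV_comp_turn_zero _ _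
    · rw [skeinProd_one_turn_zero, map_add, map_smul, map_smul, map_add, map_smul, map_smul]
      refine (congrArg₂ (fun x y => q⁻¹ • x + q • y) (toV_comp_rot _ _)
        (toV_comp_rotInv _ _)).trans ?_
      rw [add_comm q]
      exact (add_smul _ _ _).symm
  · refine Eq.trans ?_ ((one_smul ℂ _).symm.trans
      (congrArg (· • mulHom hq ha hb Y Z) (weight_of_odd hb).symm))
    obtain rfl | rfl : a = 0 ∨ a = 1 := by omega
    · rw [mulHom_of_not hq ha hb (by omega), mulHom_of_not hq ha hb (by omega),
        skeinProd_comp_right]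
      refine (congrArg (fun x => toV q _ (comp q 1 1 (m + n) _ x))
        (skeinProd_one_left hq (turn q 1))).trans ?_
      exact toV_comp_turn_one _ _
    · rw [mulHom_one_one, mulHom_one_one, skeinProd_comp_right]
      refine (congrArg _ (comp_assoc q _ _ _).symm).trans ?_
      refine (congrArg (fun x => toV q _ (comp q 0 2 (m + n) _ x))
        (skeinProd_one_turn_comp_U hq)).trans ?_
      rw [map_add, map_smul, map_sub, map_smul, comp_assoc, map_add, map_smul, map_sub, map_smul,
        toV_comp_turn_zero, sub_self, smul_zero, add_zero]

/-- Linear maps on a space of link patterns that are induced by a balanced map. -/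
noncomputable def liftV {M : Type*} [AddCommGroup M] [Module ℂ M] {n : ℕ}
    (f : HomS q (n % 2) n →ₗ[ℂ] M)
    (hf : ∀ Y, f (comp q (n % 2) (n % 2) n Y (turn q (n % 2))) = weight q n • f Y) :
    LinkSpace q n →ₗ[ℂ] M :=
  (weightSubmodule q (weight q n) n).liftQ f (Submodule.span_le.2 (by
    rintro _ ⟨Y, rfl⟩
    simp [hf]))

theorem liftV_toV {M : Type*} [AddCommGroup M] [Module ℂ M] {n : ℕ}
    (f : HomS q (n % 2) n →ₗ[ℂ] M)
    (hf : ∀ Y, f (comp q (n % 2) (n % 2) n Y (turn q (n % 2))) = weight q n • f Y)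
    (Y : HomS q (n % 2) n) : liftV f hf (toV q rfl Y) = f Y := rfl

/-- The multiplication of the algebra of link patterns. -/
noncomputable def linkMul (hq : q ≠ 0) (m n : ℕ) :
    LinkSpace q m →ₗ[ℂ] LinkSpace q n →ₗ[ℂ] LinkSpace q (m + n) :=
  liftV (LinearMap.mk₂ ℂ (fun Y => liftV (mulHom hq rfl rfl Y)
      (mulHom_comp_turn_right hq rfl rfl Y))
    (fun Y Y' z => by
      obtain ⟨Z, rfl⟩ := toV_surjective rfl z
      simp [liftV_toV])
    (fun c Y z => by
      obtain ⟨Z, rfl⟩ := toV_surjective rfl z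
      simp [liftV_toV])
    (fun Y z z' => map_add _ z z')
    (fun c Y z => map_smul _ c z))
    (fun Y => by
      refine LinearMap.ext fun z => ?_
      obtain ⟨Z, rfl⟩ := toV_surjective rfl z
      exact mulHom_comp_turn_left hq rfl rfl Y Z)

theorem linkMul_toV (hq : q ≠ 0) {a b m n : ℕ} (ha : a = m % 2) (hb : b = n % 2)
    (Y : HomS q a m) (Z : HomS q b n) :
    linkMul hq m n (toV q ha Y) (toV q hb Z) = mulHom hq ha hb Y Z := by
  subst ha hb
  rfl

theorem linkMul_of_not (hq : q ≠ 0) {a b m n : ℕ} (ha : a = m % 2) (hb : b = n % 2)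
    (h : ¬(a = 1 ∧ b = 1)) (Y : HomS q a m) (Z : HomS q b n) :
    linkMul hq m n (toV q ha Y) (toV q hb Z) =
      toV q (add_eq_mod_two ha hb h) (skeinProd hq a m b n Y Z) :=
  (linkMul_toV hq ha hb Y Z).trans (mulHom_of_not hq ha hb h Y Z)

theorem linkMul_of_and (hq : q ≠ 0) {a b m n : ℕ} (ha : a = m % 2) (hb : b = n % 2)
    (h : a = 1 ∧ b = 1) (Y : HomS q a m) (Z : HomS q b n) :
    linkMul hq m n (toV q ha Y) (toV q hb Z) = toV q (zero_eq_add_mod_two ha hb h)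
      (comp q 0 (a + b) (m + n) (skeinProd hq a m b n Y Z)
        ((U q 1).cast rfl (show 2 = a + b by omega))) :=
  (linkMul_toV hq ha hb Y Z).trans (mulHom_of_and hq ha hb h Y Z)

/-- The unit of the algebra of link patterns: the class of the empty diagram. -/
noncomputable def linkOne (q : ℂ) : LinkSpace q 0 := toV q rfl (cls q (Diagram.one 0))

theorem mk_linkMul_one_left (hq : q ≠ 0) {n : ℕ} (x : LinkSpace q n) :
    GradedMonoid.mk (A := LinkSpace q) (0 + n) (linkMul hq 0 n (linkOne q) x) = .mk n x := by
  obtain ⟨Y, rfl⟩ := toV_surjective rfl x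
  rw [linkOne, linkMul_of_not hq (a := 0) rfl rfl (by omega),
    mk_toV_cast _ rfl (Nat.zero_add _) (Nat.zero_add n), skeinProd_one_left]

theorem linkMul_one_right (hq : q ≠ 0) {n : ℕ} (x : LinkSpace q n) :
    linkMul hq n 0 x (linkOne q) = x := by
  obtain ⟨Y, rfl⟩ := toV_surjective rfl x
  rw [linkOne, linkMul_of_not hq (b := 0) rfl rfl (by omega), skeinProd_one_right]

/-- Both ways to join three strands to one strand have the same class. -/
theorem toV_comp_skeinProd_U (hq : q ≠ 0) {n : ℕ} (h : 1 = n % 2) (P : HomS q 3 n) :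
    toV q h (comp q 1 3 n P (skeinProd hq 0 2 1 1 (U q 1) (cls q (.one 1)))) =
      toV q h (comp q 1 3 n P (skeinProd hq 1 1 0 2 (cls q (.one 1)) (U q 1))) := by
  rw [skeinProd_U_one, skeinProd_one_U]
  simp only [map_add, map_smul]
  -- After `ρ` and `ρ⁻¹` are dropped, the two sums agree up to the order of their first two terms.
  rw [comp_assoc, comp_assoc, toV_comp_turn_one, toV_comp_rotInv,
    add_comm (q • toV q h (comp q 1 3 n P (ev q 1 3 [event cup 0])))]

theorem mk_linkMul_assoc (hq : q ≠ 0) {l m n : ℕ} (x : LinkSpace q l) (y : LinkSpace q m)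
    (z : LinkSpace q n) :
    GradedMonoid.mk (A := LinkSpace q) (l + m + n) (linkMul hq _ _ (linkMul hq _ _ x y) z) =
      .mk (l + (m + n)) (linkMul hq _ _ x (linkMul hq _ _ y z)) := by
  obtain ⟨a, ha⟩ : ∃ a, a = l % 2 := ⟨_, rfl⟩
  obtain ⟨b, hb⟩ : ∃ b, b = m % 2 := ⟨_, rfl⟩
  obtain ⟨c, hc⟩ : ∃ c, c = n % 2 := ⟨_, rfl⟩
  obtain ⟨Y, rfl⟩ := toV_surjective ha x
  obtain ⟨Z, rfl⟩ := toV_surjective hb y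
  obtain ⟨W, rfl⟩ := toV_surjective hc z
  -- At most one odd factor: no `U` occurs, and associativity is that of `skeinProd`.
  have plain (h1 : ¬(a = 1 ∧ b = 1)) (h2 : ¬(a + b = 1 ∧ c = 1)) (h3 : ¬(b = 1 ∧ c = 1))
      (h4 : ¬(a = 1 ∧ b + c = 1)) :
      GradedMonoid.mk (A := LinkSpace q) (l + m + n)
        (linkMul hq _ _ (linkMul hq _ _ (toV q ha Y) (toV q hb Z)) (toV q hc W)) =
      .mk (l + (m + n)) (linkMul hq _ _ (toV q ha Y) (linkMul hq _ _ (toV q hb Z) (toV q hc W))) := by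
    rw [linkMul_of_not hq ha hb h1, linkMul_of_not hq _ hc h2, linkMul_of_not hq hb hc h3,
      linkMul_of_not hq ha _ h4, mk_toV_cast _ (by omega) (Nat.add_assoc a b c)
      (Nat.add_assoc l m n), skeinProd_assoc]
  obtain rfl | rfl : a = 0 ∨ a = 1 := by omega
  · obtain rfl | rfl : b = 0 ∨ b = 1 := by omega
    · exact plain (by omega) (by omega) (by omega) (by omega)
    · obtain rfl | rfl : c = 0 ∨ c = 1 := by omega
      · exact plain (by omega) (by omega) (by omega) (by omega)
      · rw [linkMul_of_not hq ha hb (by omega), linkMul_of_and hq _ hc (by omega),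
          linkMul_of_and hq hb hc (by omega), linkMul_of_not hq ha _ (by omega),
          mk_toV_cast _ (by omega) rfl (Nat.add_assoc l m n),
          -- Two odd factors: both sides contain a single `U`. The interchange law brings it to the
          -- innermost position, where its product with the empty diagram is `U` itself.
          HomS.cast_comp _ (Nat.add_assoc 0 1 1), skeinProd_assoc]
        rw [skeinProd_comp_right]
        exact congrArg (fun x => GradedMonoid.mk (A := LinkSpace q) (l + (m + n))
          (toV q _ (comp q 0 2 (l + (m + n)) _ x))) (skeinProd_one_left hq (U q 1)).symm
  · obtain rfl | rfl : b = 0 ∨ b = 1 := by omega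
    · obtain rfl | rfl : c = 0 ∨ c = 1 := by omega
      · exact plain (by omega) (by omega) (by omega) (by omega)
      · rw [linkMul_of_not hq ha hb (by omega), linkMul_of_and hq _ hc (by omega),
          linkMul_of_not hq hb hc (by omega), linkMul_of_and hq ha _ (by omega),
          mk_toV_cast _ (by omega) rfl (Nat.add_assoc l m n),
          HomS.cast_comp _ (Nat.add_assoc 1 0 1), skeinProd_assoc]
        rfl
    · obtain rfl | rfl : c = 0 ∨ c = 1 := by omega
      · rw [linkMul_of_and hq ha hb (by omega), linkMul_of_not hq _ hc (by omega),
          linkMul_of_not hq hb hc (by omega), linkMul_of_and hq ha _ (by omega),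
          skeinProd_comp_left, skeinProd_one_right,
          mk_toV_cast _ (by omega) rfl (Nat.add_assoc l m n),
          HomS.cast_comp _ (Nat.add_assoc 1 1 0), skeinProd_assoc]
        rfl
      -- Three odd factors: the interchange law leaves `U × 1` on one side and `1 × U` on the other,
      -- inside the same triple product.
      · rw [linkMul_of_and hq ha hb (by omega), linkMul_of_not hq _ hc (by omega),
          linkMul_of_and hq hb hc (by omega), linkMul_of_not hq ha _ (by omega),
          skeinProd_comp_left, skeinProd_comp_right,
          mk_toV_cast (a' := 1) _ (by omega) rfl (Nat.add_assoc l m n),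
          HomS.cast_comp _ (Nat.add_assoc 1 1 1), skeinProd_assoc]
        exact congrArg (GradedMonoid.mk (A := LinkSpace q) (l + (m + n)))
          (toV_comp_skeinProd_U hq _ _)

end

/-! ### The graded ring and algebra structures -/

/-- The graded monoid of link patterns. -/
noncomputable abbrev linkGMonoid {q : ℂ} (hq : q ≠ 0) : GradedMonoid.GMonoid (LinkSpace q) :=
  letI : GradedMonoid.GMul (LinkSpace q) := ⟨fun x y => linkMul hq _ _ x y⟩
  letI : GradedMonoid.GOne (LinkSpace q) := ⟨linkOne q⟩
  { one_mul := fun x => mk_linkMul_one_left hq x.2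
    mul_one := fun x =>
      congrArg (GradedMonoid.mk (A := LinkSpace q) x.1) (linkMul_one_right hq x.2)
    mul_assoc := fun x y z => mk_linkMul_assoc hq x.2 y.2 z.2 }

/-- The graded ring of link patterns. -/
noncomputable abbrev linkGRing {q : ℂ} (hq : q ≠ 0) : DirectSum.GRing (LinkSpace q) where
  __ := linkGMonoid hq
  mul_zero := fun _ => map_zero _
  zero_mul := fun {i j} y => congrArg (fun f => f y) (map_zero (linkMul hq i j))
  mul_add := fun _ _ _ => map_add _ _ _
  add_mul := fun {i j} x x' y => congrArg (fun f => f y) (map_add (linkMul hq i j) x x')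
  natCast := fun n => n • linkOne q
  natCast_zero := zero_nsmul _
  natCast_succ := fun n => succ_nsmul _ n
  intCast := fun z => z • linkOne q
  intCast_ofNat := fun n => natCast_zsmul _ n
  intCast_negSucc_ofNat := fun n => negSucc_zsmul _ n

theorem linkMul_smul_one_right {q : ℂ} (hq : q ≠ 0) (r : ℂ) {n : ℕ} (x : LinkSpace q n) :
    linkMul hq n 0 x (r • linkOne q) = r • x :=
  (map_smul _ _ _).trans (congrArg (r • ·) (linkMul_one_right hq x))

theorem mk_linkMul_smul_one_left {q : ℂ} (hq : q ≠ 0) (r : ℂ) {n : ℕ} (x : LinkSpace q n) :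
    GradedMonoid.mk (A := LinkSpace q) (0 + n) (linkMul hq 0 n (r • linkOne q) x) =
      .mk n (r • x) := by
  rw [map_smul, LinearMap.smul_apply, ← map_smul]
  exact mk_linkMul_one_left hq (r • x)

/-- The graded algebra of link patterns. -/
noncomputable abbrev linkGAlgebra {q : ℂ} (hq : q ≠ 0) :
    letI := linkGRing hq
    DirectSum.GAlgebra ℂ (LinkSpace q) :=
  letI := linkGRing hq
  { toFun := (LinearMap.toSpanSingleton ℂ (LinkSpace q 0) (linkOne q)).toAddMonoidHom
    map_one := one_smul ℂ (linkOne q)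
    map_mul := fun r s => congrArg (GradedMonoid.mk (A := LinkSpace q) 0)
      (((mul_comm r s ▸ mul_smul s r (linkOne q)).trans
        (linkMul_smul_one_right hq s (r • linkOne q)).symm))
    commutes := fun r x => (mk_linkMul_smul_one_left hq r x.2).trans
      (congrArg (GradedMonoid.mk (A := LinkSpace q) x.1) (linkMul_smul_one_right hq r x.2).symm)
    smul_def := fun r x => (mk_linkMul_smul_one_left hq r x.2).symm }

end AnnularSkein


open AnnularSkein in
theorem mainTheorem3 (q : ℂ) (hq : q ≠ 0) :
    ∃ T : ∀ k l m n : ℕ, HomS q k l →ₗ[ℂ] HomS q m n →ₗ[ℂ] HomS q (k + m) (l + n),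
      (∀ (k l m n : ℕ) (D : Diagram k l) (E : Diagram m n),
        T k l m n (cls q D) (cls q E) = cls q (D.star E)) ∧
      ∃ (_ : DirectSum.GRing (LinkSpace q)) (_ : DirectSum.GAlgebra ℂ (LinkSpace q)),
        (∀ (a b m n : ℕ) (ha : a = m % 2) (hb : b = n % 2) (_ : ¬(a = 1 ∧ b = 1))
          (Y : HomS q a m) (Z : HomS q b n),
          DirectSum.of (LinkSpace q) m (toV q ha Y) * DirectSum.of (LinkSpace q) n (toV q hb Z) =
            DirectSum.of (LinkSpace q) (m + n)
              (toV q (show a + b = (m + n) % 2 by omega) (T a m b n Y Z))) ∧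
        (∀ (m n : ℕ) (hm : 1 = m % 2) (hn : 1 = n % 2) (Y : HomS q 1 m) (Z : HomS q 1 n),
          DirectSum.of (LinkSpace q) m (toV q hm Y) * DirectSum.of (LinkSpace q) n (toV q hn Z) =
            DirectSum.of (LinkSpace q) (m + n)
              (toV q (show 0 = (m + n) % 2 by omega)
                (comp q 0 2 (m + n) (T 1 m 1 n Y Z) (U q 1)))) ∧
        (1 : ⨁ n, LinkSpace q n) =
          DirectSum.of (LinkSpace q) 0 (toV q rfl (cls q (Diagram.one 0))) := by
  refine ⟨skeinProd hq, fun k l m n D E => skeinProd_cls hq D E, linkGRing hq, linkGAlgebra hq,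
    fun a b m n ha hb h Y Z => ?_, fun m n hm hn Y Z => ?_, rfl⟩
  · let _ := linkGRing hq
    rw [DirectSum.of_mul_of]
    exact congrArg _ (linkMul_of_not hq ha hb h Y Z)
  · let _ := linkGRing hq
    rw [DirectSum.of_mul_of]
    exact congrArg _ (linkMul_of_and hq hm hn ⟨rfl, rfl⟩ Y Z)
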